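/- Let $n\ge 0$, $0\le q\le n$ and $m\ge 1$ be integers. Let $\mathfrak h_n$ be the Siegel space of symmetric $Z\in M_{n\times n}(\mathbb C)$ with $\operatorname{Im} Z>0$, and let $\overline{\mathfrak h}_n$ be its Satake partial compactification, the union of all rational boundary components of $\mathfrak h_n$ ($\mathfrak h_n$ itself, the one of rank $n$, included). The group $\mathrm{Sp}(2n,\mathbb Q)$ acts on $\overline{\mathfrak h}_n$, and the involution $\tau(Z)=-\overline Z$ of $\mathfrak h_n$ extends to $\overline{\mathfrak h}_n$. For a symplectic matrix $g$ put $$\tilde g=\tau(g)=I_-\,g\,I_-,\qquad I_-=\begin{pmatrix}-I&0\\0&I\end{pmatrix},$$ so that $\tau(gx)=\tilde g\,\tau(x)$. Let $\Gamma(N)\subset \mathrm{Sp}(2n,\mathbb Z)$ be the principal congruence subgroup of level $N$. For a rational boundary component $F$ and $\gamma\in\Gamma(4m)$ let $F^{\gamma}=\{x\in F : \tau(x)=\gamma x\}$. A $\Gamma(4m)$-real boundary pair $(F,\gamma)$ of rank $q$ consists of a rational boundary component $F\cong\mathfrak h_q$ of rank $q$ and an element $\gamma\in\Gamma(4m)$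 with $F^{\gamma}\neq\emptyset$. The standard boundary component $F_q$ of rank $q$ is the set of the limits $\lim_{Y\to\infty}\begin{pmatrix}Z&0\\0&iY\end{pmatrix}$ with $Z\in\mathfrak h_q$, where $Y$ is a positive definite symmetric matrix of order $n-q$ all of whose eigenvalues tend to $\infty$. Let $P_q$ be the parabolic subgroup of the symplectic matrices of the form $$\left(\begin{array}{cc|cc}A_1&0&B_1&*\\ *&*&*&*\\ \hline C_1&0&D_1&*\\ 0&0&0&*\end{array}\right)$$ (blocks of sizes $q,\,n-q,\,q,\,n-q$), which normalizes $F_q$, and let $\nu$ be the homomorphism from $P_q$ to the symplectic group of rank $q$ that takes this matrix to $\begin{pmatrix}A_1&B_1\\C_1&D_1\end{pmatrix}$. Let $(F,\gamma)$ be a $\Gamma(4m)$-real boundary pair of rank $q$. Then there exists $a\in\mathrm{Sp}(2n,\mathbb Z)$ such that $a(F_q)=F$ and $$\tilde a^{-1}\gamma a=\begin{pmatrix}A&B\\0&{}^tA^{-1}\end{pmatrix}\in\ker\nu$$ for some $A\in\mathrm{GL}(n,\mathbb Z)$ and some integral matrix $B$. Moreover, there exist $\gamma'\in\Gamma(4m)$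 and $g\in\mathrm{Sp}(2n,\mathbb Z)$ such that $F^{\gamma'}=F^{\gamma}$, $g(F_q)=F$ and $$\tilde g^{-1}\gamma' g=\begin{pmatrix}A&0\\0&{}^tA^{-1}\end{pmatrix}\in\ker\nu$$ for some $A\in\mathrm{GL}(n,\mathbb Z)$. -/

import Mathlib

open Matrix

noncomputable section

namespace SatakeSiegel

/-! ### The symplectic group, the involution `τ`, congruence subgroups -/

/-- `Sp(2n, R)`: the matrices `g` with `g J ᵗg = J`, equivalently `ᵗg J g = J`. -/
abbrev Sp (n : ℕ) (R : Type) [CommRing R] : Type := symplecticGroup (Fin n) R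

/-- Change of the coefficient ring. -/
def Sp.map {n : ℕ} {R S : Type} [CommRing R] [CommRing S] (f : R →+* S) : Sp n R →* Sp n S where
  toFun g := ⟨g.1.map f, SymplecticGroup.map_mem g.2 f⟩
  map_one' := Subtype.ext (Matrix.map_one f (map_zero f) (map_one f))
  map_mul' _ _ := Subtype.ext Matrix.map_mul

/-- The matrix `I₋ = diag(-I, I)`. -/
def Iminus (n : ℕ) (R : Type) [CommRing R] : Matrix (Fin n ⊕ Fin n) (Fin n ⊕ Fin n) R :=
  fromBlocks (-1) 0 0 1

theorem Iminus_mul_self (n : ℕ) (R : Type) [CommRing R] : Iminus n R * Iminus n R = 1 := by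
  simp [Iminus, fromBlocks_multiply]

theorem Iminus_conj_mem {n : ℕ} {R : Type} [CommRing R] (g : Sp n R) :
    Iminus n R * g.1 * Iminus n R ∈ symplecticGroup (Fin n) R := by
  have hg := SymplecticGroup.mem_iff.1 g.2
  have hT : (Iminus n R)ᵀ = Iminus n R := by simp [Iminus, fromBlocks_transpose]
  have hJ : Iminus n R * J (Fin n) R * Iminus n R = -J (Fin n) R := by
    simp [Iminus, J, fromBlocks_multiply, fromBlocks_neg]
  rw [SymplecticGroup.mem_iff, transpose_mul, transpose_mul, hT]
  calc Iminus n R * g.1 * Iminus n R * J (Fin n) R *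
        (Iminus n R * (g.1ᵀ * Iminus n R))
      = Iminus n R * (g.1 * (Iminus n R * J (Fin n) R * Iminus n R) *
          g.1ᵀ) * Iminus n R := by simp only [Matrix.mul_assoc]
    _ = -(Iminus n R * (g.1 * J (Fin n) R * g.1ᵀ) *
          Iminus n R) := by rw [hJ]; simp
    _ = J (Fin n) R := by rw [hg, hJ, neg_neg]

/-- The involution `τ(g) = g̃ = I₋ g I₋` of `Sp(2n, R)`, that is,
`τ (A, B; C, D) = (A, -B; -C, D)`. -/
def tau {n : ℕ} {R : Type} [CommRing R] : Sp n R →* Sp n R where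
  toFun g := ⟨Iminus n R * g.1 * Iminus n R, Iminus_conj_mem g⟩
  map_one' := Subtype.ext (by
    change Iminus n R * 1 * Iminus n R = 1
    rw [Matrix.mul_one, Iminus_mul_self])
  map_mul' g h := Subtype.ext (by
    change Iminus n R * (g.1 * h.1) * Iminus n R =
      Iminus n R * g.1 * Iminus n R * (Iminus n R * h.1 * Iminus n R)
    calc _ = Iminus n R * g.1 * 1 * h.1 * Iminus n R := by
            simp only [Matrix.mul_assoc, Matrix.mul_one]
      _ = _ := by rw [← Iminus_mul_self n R]; simp only [Matrix.mul_assoc])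

/-- The principal congruence subgroup `Γ(N)` of `Sp(2n, ℤ)`. -/
def Gam (n N : ℕ) : Subgroup (Sp n ℤ) := (Sp.map (n := n) (Int.castRingHom (ZMod N))).ker

/-! ### The Satake partial compactification

The Siegel space `𝔥ₙ` is embedded in the Grassmannian of Lagrangian subspaces of `ℂ²ⁿ` (its compact
dual) by `Z ↦ {(Zx, x)}`. Under this embedding fractional linear transformations become the linear
action of `Sp(2n)`, and `𝔥ₙ` is the set of the Lagrangian subspaces on which the Hermitian form
`(u, v) ↦ Im (u · v̄)` is positive definite. Its closure consists of the Lagrangian subspaces `L` on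
which this form is positive semidefinite. The boundary components correspond to the real isotropic
subspaces `W`: the component of `W` consists of those `L` for which the radical `L ∩ L̄` of the form
is `W ⊗ ℂ`. It is rational if `W` is defined over `ℚ`, and its rank is `n - dim W`. -/

/-- Column vectors `(u, v)` with `u, v ∈ Rⁿ`. -/
abbrev Vec (n : ℕ) (R : Type) : Type := Fin n ⊕ Fin n → R

/-- The standard symplectic form `((u, v), (u', v')) ↦ u · v' - v · u'`. -/
def sympForm {n : ℕ} {R : Type} [CommRing R] (x y : Vec n R) : R :=
  ∑ i, (x (Sum.inl i) * y (Sum.inr i) - x (Sum.inr i) * y (Sum.inl i))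

/-- The Hermitian form `(u, v) ↦ Im (u · v̄)`; its value at `(Zx, x)` is `ᵗx (Im Z) x̄` for symmetric
`Z`. -/
def hermForm {n : ℕ} (x : Vec n ℂ) : ℝ :=
  (∑ i, x (Sum.inl i) * star (x (Sum.inr i))).im

/-- `L` is its own orthogonal complement for the symplectic form. -/
def IsLagrangian {n : ℕ} (L : Submodule ℂ (Vec n ℂ)) : Prop :=
  ∀ x, x ∈ L ↔ ∀ y ∈ L, sympForm y x = 0

/-- The complex conjugate `L̄` of a subspace `L` of `ℂ²ⁿ`. -/
def conj {n : ℕ} (L : Submodule ℂ (Vec n ℂ)) : Submodule ℂ (Vec n ℂ) where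
  carrier := {x | star x ∈ L}
  add_mem' {x y} hx hy := by
    change star (x + y) ∈ L
    rw [star_add]
    exact L.add_mem hx hy
  zero_mem' := by
    change star (0 : Vec n ℂ) ∈ L
    simp
  smul_mem' c x hx := by
    change star (c • x) ∈ L
    rw [star_smul]
    exact L.smul_mem _ hx

/-- The complex subspace `W ⊗ ℂ` of `ℂ²ⁿ` spanned by a rational subspace `W` of `ℚ²ⁿ`. -/
def complexify {n : ℕ} (W : Submodule ℚ (Vec n ℚ)) : Submodule ℂ (Vec n ℂ) :=
  Submodule.span ℂ ((fun w i => ((w i : ℚ) : ℂ)) '' (W : Set (Vec n ℚ)))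

/-- The boundary component of `𝔥ₙ` that belongs to a rational subspace `W`. It is empty if `W` is
not isotropic, and it is `𝔥ₙ` itself if `W = 0`. -/
def boundaryComponent {n : ℕ} (W : Submodule ℚ (Vec n ℚ)) : Set (Submodule ℂ (Vec n ℂ)) :=
  {L | IsLagrangian L ∧ (∀ x ∈ L, 0 ≤ hermForm x) ∧ L ⊓ conj L = complexify W}

/-- `F` is a rational boundary component of `𝔥ₙ` of rank `q`. -/
def IsRationalBoundaryComponent {n : ℕ} (q : ℕ) (F : Set (Submodule ℂ (Vec n ℂ))) : Prop :=
  ∃ W : Submodule ℚ (Vec n ℚ), (∀ x ∈ W, ∀ y ∈ W, sympForm x y = 0) ∧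
    Module.finrank ℚ W + q = n ∧ F = boundaryComponent W

/-- The action of `Sp(2n, R)`, for a ring `R` of coefficients such as `ℤ`, `ℚ`, `ℝ`, on subspaces
of `ℂ²ⁿ`. -/
def act {n : ℕ} {R : Type} [CommRing R] [Algebra R ℂ] (g : Sp n R)
    (L : Submodule ℂ (Vec n ℂ)) : Submodule ℂ (Vec n ℂ) :=
  L.map ((g.1.map (algebraMap R ℂ)).mulVecLin)

/-- The extension `L ↦ I₋ L̄` of the involution `τ(Z) = -Z̄` of `𝔥ₙ`. -/
def tauPt {n : ℕ} (L : Submodule ℂ (Vec n ℂ)) : Submodule ℂ (Vec n ℂ) :=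
  (conj L).map (Iminus n ℂ).mulVecLin

/-- The set `F^γ` of the `γ`-real points of `F`: the `x ∈ F` with `τ(x) = γ x`. -/
def realPoints {n : ℕ} (F : Set (Submodule ℂ (Vec n ℂ))) (γ : Sp n ℤ) :
    Set (Submodule ℂ (Vec n ℂ)) :=
  {x | x ∈ F ∧ tauPt x = act γ x}

/-- `(F, γ)` is a `Γ(4m)`-real boundary pair of rank `q`. -/
structure IsRealBoundaryPair {n : ℕ} (m q : ℕ) (F : Set (Submodule ℂ (Vec n ℂ)))
    (γ : Sp n ℤ) : Prop where
  rational : IsRationalBoundaryComponent q F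
  mem : γ ∈ Gam n (4 * m)
  nonempty : (realPoints F γ).Nonempty

/-! ### The standard boundary component, its parabolic subgroup, and `ν` -/

/-- The Siegel space `𝔥ₙ` of symmetric complex matrices with positive definite imaginary part. -/
def siegelSpace (n : ℕ) : Set (Matrix (Fin n) (Fin n) ℂ) :=
  {Z | Zᵀ = Z ∧ (Z.map Complex.im).PosDef}

/-- The embedding `Z ↦ {(Zx, x)}` of `𝔥ₙ` in the Lagrangian Grassmannian. -/
def siegelPt {n : ℕ} (Z : Matrix (Fin n) (Fin n) ℂ) : Submodule ℂ (Vec n ℂ) where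
  carrier := {w | (fun i => w (Sum.inl i)) = Z *ᵥ (fun i => w (Sum.inr i))}
  add_mem' {x y} hx hy := by
    change (fun i => x (Sum.inl i)) + (fun i => y (Sum.inl i)) =
      Z *ᵥ ((fun i => x (Sum.inr i)) + (fun i => y (Sum.inr i)))
    rw [mulVec_add, ← hx, ← hy]
  zero_mem' := by
    change (0 : Fin n → ℂ) = Z *ᵥ 0
    simp
  smul_mem' c x hx := by
    change c • (fun i => x (Sum.inl i)) = Z *ᵥ (c • (fun i => x (Sum.inr i)))
    rw [mulVec_smul, ← hx]

/-- On the points of `𝔥ₙ` the extension of `τ` is `Z ↦ -Z̄`. -/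
theorem tauPt_siegelPt {n : ℕ} (Z : Matrix (Fin n) (Fin n) ℂ) :
    tauPt (siegelPt Z) = siegelPt (-Z.map star) := by
  have key : ∀ x : Fin n → ℂ, Z.map star *ᵥ x = star (Z *ᵥ star x) := by
    intro x
    ext i
    simp [mulVec, dotProduct]
  have hI : ∀ w : Vec n ℂ, Iminus n ℂ *ᵥ w =
      Sum.elim (-(fun i => w (Sum.inl i))) (fun i => w (Sum.inr i)) := by
    intro w
    ext (i | i) <;> simp [Iminus, fromBlocks_mulVec, neg_mulVec, Function.comp_def]
  ext w
  constructor
  · rintro ⟨v, hv, rfl⟩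
    change (fun i => star (v (Sum.inl i))) = Z *ᵥ (fun i => star (v (Sum.inr i))) at hv
    change (fun i => (Iminus n ℂ *ᵥ v) (Sum.inl i)) =
      (-Z.map star) *ᵥ (fun i => (Iminus n ℂ *ᵥ v) (Sum.inr i))
    rw [hI, neg_mulVec, key]
    change -(fun i => v (Sum.inl i)) = -star (Z *ᵥ (fun i => star (v (Sum.inr i))))
    rw [← hv]
    ext i
    simp
  · intro hw
    change (fun i => w (Sum.inl i)) = (-Z.map star) *ᵥ (fun i => w (Sum.inr i)) at hw
    refine ⟨Iminus n ℂ *ᵥ w, ?_, ?_⟩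
    · change (fun i => star ((Iminus n ℂ *ᵥ w) (Sum.inl i))) =
        Z *ᵥ (fun i => star ((Iminus n ℂ *ᵥ w) (Sum.inr i)))
      rw [hI]
      change (fun i => star (-(w (Sum.inl i)))) = Z *ᵥ (star (fun i => w (Sum.inr i)))
      rw [neg_mulVec, key] at hw
      ext i
      have := congrFun hw i
      simp only [this]
      simp
    · change Iminus n ℂ *ᵥ (Iminus n ℂ *ᵥ w) = w
      rw [mulVec_mulVec, Iminus_mul_self, one_mulVec]

/-- On the points of `𝔥ₙ` the action is the one by fractional linear transformations
`Z ↦ (A Z + B) (C Z + D)⁻¹`. -/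
theorem act_siegelPt {n : ℕ} (g : Sp n ℝ) {A B C D : Matrix (Fin n) (Fin n) ℂ}
    (hg : g.1.map (algebraMap ℝ ℂ) = fromBlocks A B C D) (Z : Matrix (Fin n) (Fin n) ℂ)
    (hu : IsUnit (C * Z + D).det) :
    act g (siegelPt Z) = siegelPt ((A * Z + B) * (C * Z + D)⁻¹) := by
  have hG : ∀ x : Fin n → ℂ, fromBlocks A B C D *ᵥ (Sum.elim (Z *ᵥ x) x) =
      Sum.elim ((A * Z + B) *ᵥ x) ((C * Z + D) *ᵥ x) := by
    intro x
    rw [fromBlocks_mulVec]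
    simp [add_mulVec, mulVec_mulVec]
  ext w
  constructor
  · rintro ⟨v, hv, rfl⟩
    change (fun i => v (Sum.inl i)) = Z *ᵥ (fun i => v (Sum.inr i)) at hv
    have hv' : v = Sum.elim (Z *ᵥ fun i => v (Sum.inr i)) (fun i => v (Sum.inr i)) := by
      rw [← hv]
      ext (i | i) <;> rfl
    rw [hg, mulVecLin_apply, hv', hG]
    change (A * Z + B) *ᵥ _ = ((A * Z + B) * (C * Z + D)⁻¹) *ᵥ ((C * Z + D) *ᵥ _)
    rw [mulVec_mulVec, Matrix.mul_assoc, nonsing_inv_mul _ hu, Matrix.mul_one]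
  · intro hw
    change (fun i => w (Sum.inl i)) =
      ((A * Z + B) * (C * Z + D)⁻¹) *ᵥ (fun i => w (Sum.inr i)) at hw
    refine ⟨Sum.elim (Z *ᵥ ((C * Z + D)⁻¹ *ᵥ fun i => w (Sum.inr i)))
      ((C * Z + D)⁻¹ *ᵥ fun i => w (Sum.inr i)), rfl, ?_⟩
    rw [hg, mulVecLin_apply, hG, mulVec_mulVec, mulVec_mulVec, ← hw, mul_nonsing_inv _ hu,
      one_mulVec]
    ext (i | i) <;> rfl

/-- The point `φ(Z) = lim diag(Z, iY)` for `Z ∈ 𝔥_q` and `Y → ∞`. The Lagrangian subspace of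
`diag(Z, iY)` is `{(Zx, t; x, -iY⁻¹t)}`, with the limit `{(Zx, t; x, 0)}`. -/
def phi {n q : ℕ} (hq : q ≤ n) (Z : Matrix (Fin q) (Fin q) ℂ) : Submodule ℂ (Vec n ℂ) where
  carrier := {w | (∀ j : Fin n, q ≤ (j : ℕ) → w (Sum.inr j) = 0) ∧
    (fun i : Fin q => w (Sum.inl (Fin.castLE hq i))) =
      Z *ᵥ (fun i : Fin q => w (Sum.inr (Fin.castLE hq i)))}
  add_mem' {x y} hx hy := by
    refine ⟨fun j hj => ?_, ?_⟩
    · rw [Pi.add_apply, hx.1 j hj, hy.1 j hj, add_zero]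
    · change (fun i : Fin q => x (Sum.inl (Fin.castLE hq i))) +
          (fun i : Fin q => y (Sum.inl (Fin.castLE hq i))) =
        Z *ᵥ ((fun i : Fin q => x (Sum.inr (Fin.castLE hq i))) +
          (fun i : Fin q => y (Sum.inr (Fin.castLE hq i))))
      rw [mulVec_add, ← hx.2, ← hy.2]
  zero_mem' := by
    refine ⟨fun j hj => rfl, ?_⟩
    change (0 : Fin q → ℂ) = Z *ᵥ 0
    simp
  smul_mem' c x hx := by
    refine ⟨fun j hj => ?_, ?_⟩
    · rw [Pi.smul_apply, hx.1 j hj, smul_zero]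
    · change c • (fun i : Fin q => x (Sum.inl (Fin.castLE hq i))) =
        Z *ᵥ (c • (fun i : Fin q => x (Sum.inr (Fin.castLE hq i))))
      rw [mulVec_smul, ← hx.2]

/-- The standard boundary component `F_q = φ(𝔥_q)` of rank `q`. -/
def stdComponent (n : ℕ) {q : ℕ} (hq : q ≤ n) : Set (Submodule ℂ (Vec n ℂ)) :=
  phi hq '' siegelSpace q

/-- The block shape of the elements of `P_q`. -/
def IsParabolicShape {n : ℕ} {R : Type} [CommRing R] (q : ℕ)
    (g : Matrix (Fin n ⊕ Fin n) (Fin n ⊕ Fin n) R) : Prop :=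
  (∀ i j : Fin n, (i : ℕ) < q → q ≤ (j : ℕ) → g (Sum.inl i) (Sum.inl j) = 0) ∧
  (∀ i j : Fin n, q ≤ (j : ℕ) → g (Sum.inr i) (Sum.inl j) = 0) ∧
  (∀ i j : Fin n, q ≤ (i : ℕ) → g (Sum.inr i) (Sum.inl j) = 0) ∧
  (∀ i j : Fin n, q ≤ (i : ℕ) → (j : ℕ) < q → g (Sum.inr i) (Sum.inr j) = 0)

theorem isParabolicShape_one {n : ℕ} {R : Type} [CommRing R] (q : ℕ) :
    IsParabolicShape q (1 : Matrix (Fin n ⊕ Fin n) (Fin n ⊕ Fin n) R) := by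
  refine ⟨?_, ?_, ?_, ?_⟩
  · intro i j hi hj
    exact Matrix.one_apply_ne (fun h => by cases h; omega)
  · intro i j _
    exact Matrix.one_apply_ne (by simp)
  · intro i j _
    exact Matrix.one_apply_ne (by simp)
  · intro i j hi hj
    exact Matrix.one_apply_ne (fun h => by cases h; omega)

theorem isParabolicShape_mul {n q : ℕ} {R : Type} [CommRing R]
    {g h : Matrix (Fin n ⊕ Fin n) (Fin n ⊕ Fin n) R}
    (hg : IsParabolicShape q g) (hh : IsParabolicShape q h) : IsParabolicShape q (g * h) := by
  obtain ⟨g1, g2, g3, g4⟩ := hg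
  obtain ⟨h1, h2, h3, h4⟩ := hh
  refine ⟨?_, ?_, ?_, ?_⟩
  · intro i j hi hj
    rw [Matrix.mul_apply, Fintype.sum_sum_type]
    refine (congrArg₂ (· + ·) (Finset.sum_eq_zero fun k _ => ?_)
      (Finset.sum_eq_zero fun k _ => ?_)).trans (add_zero 0)
    · rcases lt_or_ge (k : ℕ) q with hk | hk
      · rw [h1 k j hk hj, mul_zero]
      · rw [g1 i k hi hk, zero_mul]
    · rw [h2 k j hj, mul_zero]
  · intro i j hj
    rw [Matrix.mul_apply, Fintype.sum_sum_type]
    refine (congrArg₂ (· + ·) (Finset.sum_eq_zero fun k _ => ?_)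
      (Finset.sum_eq_zero fun k _ => ?_)).trans (add_zero 0)
    · rcases lt_or_ge (k : ℕ) q with hk | hk
      · rw [h1 k j hk hj, mul_zero]
      · rw [g2 i k hk, zero_mul]
    · rw [h2 k j hj, mul_zero]
  · intro i j hi
    rw [Matrix.mul_apply, Fintype.sum_sum_type]
    refine (congrArg₂ (· + ·) (Finset.sum_eq_zero fun k _ => ?_)
      (Finset.sum_eq_zero fun k _ => ?_)).trans (add_zero 0)
    · rw [g3 i k hi, zero_mul]
    · rcases lt_or_ge (k : ℕ) q with hk | hk
      · rw [g4 i k hi hk, zero_mul]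
      · rw [h3 k j hk, mul_zero]
  · intro i j hi hj
    rw [Matrix.mul_apply, Fintype.sum_sum_type]
    refine (congrArg₂ (· + ·) (Finset.sum_eq_zero fun k _ => ?_)
      (Finset.sum_eq_zero fun k _ => ?_)).trans (add_zero 0)
    · rw [g3 i k hi, zero_mul]
    · rcases lt_or_ge (k : ℕ) q with hk | hk
      · rw [g4 i k hi hk, zero_mul]
      · rw [h4 k j hk hj, mul_zero]

theorem coe_inv_eq {n : ℕ} {R : Type} [CommRing R] (g : Sp n R) :
    (g⁻¹).1 = fromBlocks (g.1.toBlocks₂₂ᵀ) (-g.1.toBlocks₁₂ᵀ) (-g.1.toBlocks₂₁ᵀ)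
      (g.1.toBlocks₁₁ᵀ) := by
  have h := SymplecticGroup.coe_inv g
  rw [← fromBlocks_toBlocks g.1] at h
  rw [h]
  simp [J, fromBlocks_multiply, fromBlocks_transpose, fromBlocks_neg]

theorem coe_inv_inl_inl {n : ℕ} {R : Type} [CommRing R] (g : Sp n R) (i j : Fin n) :
    (g⁻¹).1 (Sum.inl i) (Sum.inl j) = g.1 (Sum.inr j) (Sum.inr i) := by
  rw [coe_inv_eq]
  rfl

theorem coe_inv_inr_inl {n : ℕ} {R : Type} [CommRing R] (g : Sp n R) (i j : Fin n) :
    (g⁻¹).1 (Sum.inr i) (Sum.inl j) = -g.1 (Sum.inr j) (Sum.inl i) := by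
  rw [coe_inv_eq]
  rfl

theorem coe_inv_inr_inr {n : ℕ} {R : Type} [CommRing R] (g : Sp n R) (i j : Fin n) :
    (g⁻¹).1 (Sum.inr i) (Sum.inr j) = g.1 (Sum.inl j) (Sum.inl i) := by
  rw [coe_inv_eq]
  rfl

/-- The parabolic subgroup `P_q` of `Sp(2n, R)`, which consists of the symplectic matrices
`(A, 0, B, *; *, *, *, *; C, 0, D, *; 0, 0, 0, *)` with blocks of sizes `q, n - q, q, n - q`. -/
def parabolic (n q : ℕ) (R : Type) [CommRing R] : Subgroup (Sp n R) where
  carrier := {g | IsParabolicShape q g.1}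
  mul_mem' {g h} hg hh := isParabolicShape_mul hg hh
  one_mem' := isParabolicShape_one q
  inv_mem' {g} hg := by
    obtain ⟨h1, h2, h3, h4⟩ := hg
    change IsParabolicShape q (g⁻¹).1
    refine ⟨?_, ?_, ?_, ?_⟩
    · intro i j hi hj
      rw [coe_inv_inl_inl, h4 j i hj hi]
    · intro i j hj
      rw [coe_inv_inr_inl, h3 j i hj, neg_zero]
    · intro i j hi
      rw [coe_inv_inr_inl, h2 j i hi, neg_zero]
    · intro i j hi hj
      rw [coe_inv_inr_inr, h1 j i hj hi]

/-- The inclusion of the coordinates of the Hermitian factor `Sp(2q)` in those of `Sp(2n)`. -/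
def hermIdx {n q : ℕ} (hq : q ≤ n) : Fin q ⊕ Fin q → Fin n ⊕ Fin n :=
  Sum.map (Fin.castLE hq) (Fin.castLE hq)

theorem hermIdx_injective {n q : ℕ} (hq : q ≤ n) : Function.Injective (hermIdx hq) :=
  Sum.map_injective.2 ⟨Fin.castLE_injective hq, Fin.castLE_injective hq⟩

theorem sum_hermIdx {n q : ℕ} (hq : q ≤ n) {R : Type} [CommRing R] (f : Fin n ⊕ Fin n → R)
    (hl : ∀ i : Fin n, q ≤ (i : ℕ) → f (Sum.inl i) = 0)
    (hr : ∀ i : Fin n, q ≤ (i : ℕ) → f (Sum.inr i) = 0) :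
    ∑ k, f (hermIdx hq k) = ∑ k, f k := by
  refine Fintype.sum_of_injective (hermIdx hq) (hermIdx_injective hq) _ _ ?_ (fun _ => rfl)
  rintro (k | k) hk
  · refine hl k (not_lt.1 fun hlt => hk ⟨Sum.inl ⟨k, hlt⟩, rfl⟩)
  · refine hr k (not_lt.1 fun hlt => hk ⟨Sum.inr ⟨k, hlt⟩, rfl⟩)

theorem submatrix_hermIdx_mul {n q : ℕ} (hq : q ≤ n) {R : Type} [CommRing R]
    {g h : Matrix (Fin n ⊕ Fin n) (Fin n ⊕ Fin n) R}
    (hg : IsParabolicShape q g) (hh : IsParabolicShape q h) :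
    (g * h).submatrix (hermIdx hq) (hermIdx hq) =
      g.submatrix (hermIdx hq) (hermIdx hq) * h.submatrix (hermIdx hq) (hermIdx hq) := by
  ext i j
  simp only [submatrix_apply, Matrix.mul_apply]
  refine (sum_hermIdx hq (fun k => g (hermIdx hq i) k * h k (hermIdx hq j)) ?_ ?_).symm
  · intro k hk
    rcases i with i | i
    · exact mul_eq_zero_of_left (hg.1 _ k i.2 hk) _
    · exact mul_eq_zero_of_left (hg.2.1 _ k hk) _
  · intro k hk
    rcases j with j | j
    · exact mul_eq_zero_of_right _ (hh.2.2.1 k _ hk)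
    · exact mul_eq_zero_of_right _ (hh.2.2.2 k _ hk j.2)

theorem submatrix_hermIdx_mem {n q : ℕ} (hq : q ≤ n) {R : Type} [CommRing R]
    (g : parabolic n q R) :
    g.1.1.submatrix (hermIdx hq) (hermIdx hq) ∈ symplecticGroup (Fin q) R := by
  have hinv : IsParabolicShape q (g⁻¹).1.1 := (g⁻¹).2
  have h1 := submatrix_hermIdx_mul hq g.2 hinv
  have h2 : g.1.1 * (g⁻¹).1.1 = 1 := congrArg Subtype.val (mul_inv_cancel g.1)
  rw [h2, submatrix_one _ (hermIdx_injective hq)] at h1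
  have h3 : (g⁻¹).1.1.submatrix (hermIdx hq) (hermIdx hq) =
      -J (Fin q) R * (g.1.1.submatrix (hermIdx hq) (hermIdx hq))ᵀ * J (Fin q) R := by
    have h4 : (g⁻¹).1.1 = (g.1⁻¹).1 := rfl
    rw [h4, coe_inv_eq]
    rw [← fromBlocks_toBlocks (g.1.1.submatrix (hermIdx hq) (hermIdx hq))]
    simp only [J, fromBlocks_multiply, fromBlocks_transpose, fromBlocks_neg]
    ext (i | i) (j | j) <;> simp [hermIdx, toBlocks₁₁, toBlocks₁₂, toBlocks₂₁, toBlocks₂₂]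
  rw [h3] at h1
  rw [SymplecticGroup.mem_iff]
  have h5 := congrArg (fun M => -(M * J (Fin q) R)) h1
  simpa [Matrix.mul_assoc, J_squared] using h5.symm

/-- The projection `ν : P_q → G_h ≅ Sp(2q, R)` to the Hermitian factor, which takes
`(A, 0, B, *; *, *, *, *; C, 0, D, *; 0, 0, 0, *)` to `(A, B; C, D)`. -/
def nu {n q : ℕ} (hq : q ≤ n) (R : Type) [CommRing R] : parabolic n q R →* Sp q R where
  toFun g := ⟨g.1.1.submatrix (hermIdx hq) (hermIdx hq),
    submatrix_hermIdx_mem hq g⟩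
  map_one' := Subtype.ext (submatrix_one _ (hermIdx_injective hq))
  map_mul' g h := Subtype.ext (submatrix_hermIdx_mul hq g.2 h.2)

/-- `ker ν`, as a subgroup of `Sp(2n, R)`. -/
def kerNu {n q : ℕ} (hq : q ≤ n) (R : Type) [CommRing R] : Subgroup (Sp n R) :=
  (nu hq R).ker.map (parabolic n q R).subtype

end SatakeSiegel

end

/-! The proof conjugates `F` to the standard component and normalizes the real structure there in
two stages, first on the Hermitian factor and then on the unipotent part.

Write `δ = ã⁻¹γa` for the twisted conjugate of `γ` by `a`. Two congruences survive every such
conjugation. Since `I₋ ≡ 1` modulo 2, `δ` stays in `Γ(2)`. The norm `δ̃δ = a⁻¹(γ̃γ)a` stays in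
`Γ(8m)`: if `γ = 1 + 4mX`, then the linear term of `γ̃γ` is `4m(X + X̃)`, and `X + X̃` is even
(`tau_mul_self_mem_Gam`).

A rational isotropic subspace is an `Sp(2n, ℤ)`-translate of the standard one
(`exists_act_stdRadical_eq`): extend its integral points to a Lagrangian lattice and complete an
adapted basis to a symplectic basis. Hence `F` may be taken to be `F_q`. A real point then forces
`δ` into `P_q`, and `ν(δ̃δ)` fixes a point of `𝔥_q`. An integral symplectic matrix that is congruent
to 1 modulo 4 and fixes a point of `𝔥_q` is 1 (`eq_one_of_act_eq`), so `h = ν(δ)` satisfies `h̃h =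
1`. Then `I₋h` is an antisymplectic involution congruent to 1 modulo 2, so its eigenlattices split
`ℤ^{2q}` into two Lagrangian summands, and a symplectic basis adapted to them gives `b` with `hb =
b̃` (`exists_tau_eq_mul`). Twisted conjugation by `b`, embedded in `Sp(2n, ℤ)`, moves `δ` into `ker
ν`, whose elements are block upper triangular. This is the first claim.

For the second, let `δ = (A, B; 0, D)`. The first congruence gives `B = 2B₀`, the second `AB₀ ≡ B₀D`
modulo `4m`. Put `S = ᵗD B₀`, which is symmetric. Twisted conjugation by the translation by `-S`
removes `B` up to a translation by a matrix divisible by `4m`, which can be absorbed in `γ`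
(`exists_translations`). All these translations lie in `ker ν`, so they act trivially on `F_q` and
change neither the component nor the real points. -/

noncomputable section

namespace SatakeSiegel

/-! ### The symplectic form -/

section SympForm

variable {n : ℕ} {R : Type} [CommRing R]

/-- The symplectic form as a bilinear map. -/
def sympBilin (n : ℕ) (R : Type) [CommRing R] : Vec n R →ₗ[R] Vec n R →ₗ[R] R :=
  LinearMap.mk₂ R sympForm
    (fun x y z => by simp only [sympForm, Pi.add_apply, ← Finset.sum_add_distrib]; congr! 1; ring)
    (fun c x y => by
      simp only [sympForm, Pi.smul_apply, smul_eq_mul, Finset.mul_sum]; congr! 1; ring)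
    (fun x y z => by simp only [sympForm, Pi.add_apply, ← Finset.sum_add_distrib]; congr! 1; ring)
    (fun c x y => by
      simp only [sympForm, Pi.smul_apply, smul_eq_mul, Finset.mul_sum]; congr! 1; ring)

theorem sympBilin_apply (x y : Vec n R) : sympBilin n R x y = sympForm x y := rfl

theorem sympForm_add_left (x y z : Vec n R) :
    sympForm (x + y) z = sympForm x z + sympForm y z := by
  simp [← sympBilin_apply]

theorem sympForm_add_right (x y z : Vec n R) :
    sympForm x (y + z) = sympForm x y + sympForm x z := by
  simp [← sympBilin_apply]

theorem sympForm_smul_left (c : R) (x y : Vec n R) : sympForm (c • x) y = c * sympForm x y := by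
  simp [← sympBilin_apply]

theorem sympForm_smul_right (c : R) (x y : Vec n R) : sympForm x (c • y) = c * sympForm x y := by
  simp [← sympBilin_apply]

theorem sympForm_zero_right (x : Vec n R) : sympForm x 0 = 0 := by
  simp [← sympBilin_apply]

theorem sympForm_swap (x y : Vec n R) : sympForm y x = -sympForm x y := by
  simp only [sympForm, ← Finset.sum_neg_distrib]
  congr! 1; ring

theorem sympForm_self (x : Vec n R) : sympForm x x = 0 := by
  simp [sympForm, mul_comm]

theorem sympForm_eq_dotProduct (x y : Vec n R) :
    sympForm x y = -(x ⬝ᵥ (J (Fin n) R *ᵥ y)) := by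
  simp [sympForm, dotProduct, J, fromBlocks_mulVec, Fintype.sum_sum_type, neg_mulVec,
    sub_eq_add_neg, Finset.sum_add_distrib, add_comm]

theorem sympForm_mulVec_mulVec (g : Matrix (Fin n ⊕ Fin n) (Fin n ⊕ Fin n) R) (x y : Vec n R) :
    sympForm (g *ᵥ x) (g *ᵥ y) = -(x ⬝ᵥ ((gᵀ * J (Fin n) R * g) *ᵥ y)) := by
  rw [sympForm_eq_dotProduct, ← mulVec_mulVec, ← mulVec_mulVec, dotProduct_mulVec x gᵀ,
    vecMul_transpose]

theorem sympForm_mulVec {g : Matrix (Fin n ⊕ Fin n) (Fin n ⊕ Fin n) R}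
    (hg : g ∈ symplecticGroup (Fin n) R) (x y : Vec n R) :
    sympForm (g *ᵥ x) (g *ᵥ y) = sympForm x y := by
  rw [sympForm_mulVec_mulVec, SymplecticGroup.mem_iff'.1 hg, sympForm_eq_dotProduct]

theorem mem_symplecticGroup_of_col {g : Matrix (Fin n ⊕ Fin n) (Fin n ⊕ Fin n) R}
    (hg : ∀ i j, sympForm (g.col i) (g.col j) = -J (Fin n) R i j) :
    g ∈ symplecticGroup (Fin n) R := by
  rw [SymplecticGroup.mem_iff']
  ext i j
  have := hg i j
  rw [← mulVec_single_one, ← mulVec_single_one, sympForm_mulVec_mulVec, neg_inj] at this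
  simpa using this

/-- Every linear form is represented by the symplectic form. -/
theorem exists_sympForm_eq (f : Vec n R →ₗ[R] R) : ∃ z, ∀ x, f x = sympForm x z := by
  refine ⟨Sum.elim (fun i => -f (Pi.single (Sum.inr i) 1)) (fun i => f (Pi.single (Sum.inl i) 1)),
    fun x => ?_⟩
  conv_lhs => rw [← Finset.univ_sum_single x, map_sum, Fintype.sum_sum_type]
  have h : ∀ i, f (Pi.single i (x i)) = x i * f (Pi.single i 1) := fun i => by
    rw [← smul_eq_mul, ← map_smul, ← Pi.single_smul, smul_eq_mul, mul_one]
  simp only [h, sympForm, Sum.elim_inl, Sum.elim_inr, ← Finset.sum_add_distrib]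
  congr! 1; ring

theorem eq_zero_of_sympForm {z : Vec n R} (h : ∀ x, sympForm x z = 0) : z = 0 := by
  ext (i | i)
  · simpa [sympForm, Pi.single_apply] using h (Pi.single (Sum.inr i) 1)
  · simpa [sympForm, Pi.single_apply] using h (Pi.single (Sum.inl i) 1)

end SympForm

/-! ### The Hermitian form, complex conjugation and the action -/

section Action

variable {n : ℕ}

theorem sympForm_star (x y : Vec n ℂ) : sympForm (star x) (star y) = star (sympForm x y) := by
  simp [sympForm]

theorem hermForm_eq (x : Vec n ℂ) : hermForm x = (sympForm x (star x)).im / 2 := by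
  simp only [hermForm, sympForm, Complex.im_sum, Finset.sum_div]
  congr! 1
  simp
  ring

theorem hermForm_add_smul (x y : Vec n ℂ) (c : ℂ) :
    hermForm (y + c • x) =
      hermForm y + Complex.normSq c * hermForm x + (star c * sympForm y (star x)).im := by
  have h : sympForm x (star y) = -star (sympForm y (star x)) := by
    rw [sympForm_swap, ← sympForm_star, star_star]
  simp only [hermForm_eq, star_add, star_smul, sympForm_add_left, sympForm_add_right,
    sympForm_smul_left, sympForm_smul_right, h]
  simp [Complex.normSq_apply]
  ring

/-- Cauchy–Schwarz inequality for a semidefinite Hermitian form whose polarization is, up to a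
factor, `sympForm y (star x)`. -/
theorem im_sq_le_of_hermForm {L : Submodule ℂ (Vec n ℂ)} (h0 : ∀ x ∈ L, 0 ≤ hermForm x)
    {x y : Vec n ℂ} (hx : x ∈ L) (hy : y ∈ L) :
    Complex.normSq (sympForm y (star x)) ≤ 4 * hermForm x * hermForm y := by
  set s := sympForm y (star x) with hs
  have key : ∀ t : ℝ, 0 ≤ Complex.normSq s * hermForm x * (t * t) + -Complex.normSq s * t +
      hermForm y := by
    intro t
    -- With `c = t i s` the cross term `Im (c̄ s)` equals `-t |s|²`, so nonnegativity is a real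
    -- quadratic inequality in `t`, to be read off from its discriminant.
    have := h0 _ (L.add_mem hy (L.smul_mem ((t : ℂ) * Complex.I * s) hx))
    rw [hermForm_add_smul, ← hs] at this
    simp [Complex.normSq_apply] at this
    simp only [Complex.normSq_apply]
    linarith
  have hd := discrim_le_zero key
  rw [discrim] at hd
  rcases (Complex.normSq_nonneg s).eq_or_lt with h | h
  · rw [← h]
    have := mul_nonneg (h0 x hx) (h0 y hy)
    linarith
  · nlinarith

/-- The complex matrix of an integral symplectic matrix. -/
abbrev cmat (g : Sp n ℤ) : Matrix (Fin n ⊕ Fin n) (Fin n ⊕ Fin n) ℂ :=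
  g.1.map (algebraMap ℤ ℂ)

theorem cmat_mem (g : Sp n ℤ) : cmat g ∈ symplecticGroup (Fin n) ℂ :=
  SymplecticGroup.map_mem g.2 (algebraMap ℤ ℂ)

theorem cmat_mul (g h : Sp n ℤ) : cmat (g * h) = cmat g * cmat h :=
  Matrix.map_mul

theorem cmat_one : cmat (1 : Sp n ℤ) = 1 :=
  Matrix.map_one _ (map_zero _) (map_one _)

theorem star_cmat_mulVec (g : Sp n ℤ) (x : Vec n ℂ) : star (cmat g *ᵥ x) = cmat g *ᵥ star x := by
  ext i
  simp [mulVec, dotProduct]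

theorem star_Iminus_mulVec (x : Vec n ℂ) : star (Iminus n ℂ *ᵥ x) = Iminus n ℂ *ᵥ star x := by
  ext (i | i) <;> simp [Iminus, fromBlocks_mulVec, neg_mulVec]

theorem cmat_tau (g : Sp n ℤ) : cmat (tau g) = Iminus n ℂ * cmat g * Iminus n ℂ := by
  have h : (Iminus n ℤ).map (algebraMap ℤ ℂ) = Iminus n ℂ := by
    simp [Iminus, fromBlocks_map, Matrix.map_neg]
  rw [← h, ← Matrix.map_mul, ← Matrix.map_mul]
  rfl

theorem cmat_inv_mulVec (g : Sp n ℤ) (x : Vec n ℂ) : cmat g⁻¹ *ᵥ (cmat g *ᵥ x) = x := by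
  rw [mulVec_mulVec, ← cmat_mul, inv_mul_cancel, cmat_one, one_mulVec]

theorem cmat_mulVec_inv (g : Sp n ℤ) (x : Vec n ℂ) : cmat g *ᵥ (cmat g⁻¹ *ᵥ x) = x := by
  rw [mulVec_mulVec, ← cmat_mul, mul_inv_cancel, cmat_one, one_mulVec]

theorem Iminus_mulVec_self (x : Vec n ℂ) : Iminus n ℂ *ᵥ (Iminus n ℂ *ᵥ x) = x := by
  rw [mulVec_mulVec, Iminus_mul_self, one_mulVec]

theorem mem_conj {L : Submodule ℂ (Vec n ℂ)} {x : Vec n ℂ} : x ∈ conj L ↔ star x ∈ L := Iff.rfl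

theorem mem_act {g : Sp n ℤ} {L : Submodule ℂ (Vec n ℂ)} {x : Vec n ℂ} :
    x ∈ act g L ↔ cmat g⁻¹ *ᵥ x ∈ L := by
  constructor
  · rintro ⟨y, hy, rfl⟩
    rw [mulVecLin_apply, cmat_inv_mulVec]
    exact hy
  · exact fun h => ⟨_, h, cmat_mulVec_inv g x⟩

theorem mulVec_mem_act {g : Sp n ℤ} {L : Submodule ℂ (Vec n ℂ)} {x : Vec n ℂ} :
    cmat g *ᵥ x ∈ act g L ↔ x ∈ L := by
  rw [mem_act, cmat_inv_mulVec]

theorem mem_tauPt {L : Submodule ℂ (Vec n ℂ)} {x : Vec n ℂ} :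
    x ∈ tauPt L ↔ Iminus n ℂ *ᵥ star x ∈ L := by
  constructor
  · rintro ⟨y, hy, rfl⟩
    rw [mulVecLin_apply, star_Iminus_mulVec, Iminus_mulVec_self]
    exact hy
  · intro h
    refine ⟨Iminus n ℂ *ᵥ x, ?_, Iminus_mulVec_self x⟩
    change star _ ∈ L
    rwa [star_Iminus_mulVec]

theorem act_mul (g h : Sp n ℤ) (L : Submodule ℂ (Vec n ℂ)) : act (g * h) L = act g (act h L) := by
  ext x
  rw [mem_act, mem_act, mem_act, _root_.mul_inv_rev, cmat_mul, mulVec_mulVec]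

theorem act_one (L : Submodule ℂ (Vec n ℂ)) : act (1 : Sp n ℤ) L = L := by
  ext x
  rw [mem_act, inv_one, cmat_one, one_mulVec]

theorem act_inv_act (g : Sp n ℤ) (L : Submodule ℂ (Vec n ℂ)) : act g⁻¹ (act g L) = L := by
  rw [← act_mul, inv_mul_cancel, act_one]

theorem act_act_inv (g : Sp n ℤ) (L : Submodule ℂ (Vec n ℂ)) : act g (act g⁻¹ L) = L := by
  rw [← act_mul, mul_inv_cancel, act_one]

theorem act_inf (g : Sp n ℤ) (L L' : Submodule ℂ (Vec n ℂ)) :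
    act g (L ⊓ L') = act g L ⊓ act g L' := by
  ext x
  simp only [mem_act, Submodule.mem_inf]

theorem conj_act (g : Sp n ℤ) (L : Submodule ℂ (Vec n ℂ)) : conj (act g L) = act g (conj L) := by
  ext x
  rw [mem_conj, mem_act, mem_act, mem_conj, star_cmat_mulVec]

theorem tauPt_tauPt (L : Submodule ℂ (Vec n ℂ)) : tauPt (tauPt L) = L := by
  ext x
  rw [mem_tauPt, mem_tauPt, star_Iminus_mulVec, Iminus_mulVec_self, star_star]

theorem tau_tau {R : Type} [CommRing R] (g : Sp n R) : tau (tau g) = g := by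
  refine Subtype.ext ?_
  change Iminus n R * (Iminus n R * g.1 * Iminus n R) * Iminus n R = g.1
  calc _ = (Iminus n R * Iminus n R) * g.1 * (Iminus n R * Iminus n R) := by
        simp only [Matrix.mul_assoc]
    _ = _ := by simp [Iminus_mul_self]

theorem tauPt_act (g : Sp n ℤ) (L : Submodule ℂ (Vec n ℂ)) :
    tauPt (act g L) = act (tau g) (tauPt L) := by
  ext x
  rw [mem_tauPt, mem_act, mem_act, mem_tauPt, star_cmat_mulVec, ← map_inv, cmat_tau,
    mulVec_mulVec, mulVec_mulVec, ← Matrix.mul_assoc, ← Matrix.mul_assoc, Iminus_mul_self,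
    Matrix.one_mul]

theorem tauPt_inf_conj (L : Submodule ℂ (Vec n ℂ)) :
    tauPt L ⊓ conj (tauPt L) = tauPt (L ⊓ conj L) := by
  ext x
  simp only [Submodule.mem_inf, mem_tauPt, mem_conj, star_star, star_Iminus_mulVec]

theorem hermForm_cmat (g : Sp n ℤ) (x : Vec n ℂ) : hermForm (cmat g *ᵥ x) = hermForm x := by
  rw [hermForm_eq, hermForm_eq, star_cmat_mulVec, sympForm_mulVec (cmat_mem g)]

/-- The Lagrangian subspaces on which the Hermitian form is positive semidefinite, with the
radical `V`. -/
def component (V : Submodule ℂ (Vec n ℂ)) : Set (Submodule ℂ (Vec n ℂ)) :=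
  {L | IsLagrangian L ∧ (∀ x ∈ L, 0 ≤ hermForm x) ∧ L ⊓ conj L = V}

theorem boundaryComponent_eq (W : Submodule ℚ (Vec n ℚ)) :
    boundaryComponent W = component (complexify W) := rfl

theorem isLagrangian_act {L : Submodule ℂ (Vec n ℂ)} (hL : IsLagrangian L) (g : Sp n ℤ) :
    IsLagrangian (act g L) := by
  intro x
  rw [mem_act, hL]
  constructor
  · intro h y hy
    rw [← sympForm_mulVec (cmat_mem g⁻¹)]
    exact h _ (mem_act.1 hy)
  · intro h y hy
    rw [← sympForm_mulVec (cmat_mem g), cmat_mulVec_inv]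
    exact h _ (mulVec_mem_act.2 hy)

theorem act_mem_component {V L : Submodule ℂ (Vec n ℂ)} (hL : L ∈ component V) (g : Sp n ℤ) :
    act g L ∈ component (act g V) := by
  refine ⟨isLagrangian_act hL.1 g, fun x hx => ?_, ?_⟩
  · rw [← hermForm_cmat g⁻¹]
    exact hL.2.1 _ (mem_act.1 hx)
  · rw [conj_act, ← act_inf, hL.2.2]

theorem act_image_component (V : Submodule ℂ (Vec n ℂ)) (g : Sp n ℤ) :
    act g '' component V = component (act g V) := by
  refine Set.Subset.antisymm ?_ fun L hL => ⟨act g⁻¹ L, ?_, act_act_inv g L⟩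
  · rintro _ ⟨L, hL, rfl⟩
    exact act_mem_component hL g
  · simpa only [act_inv_act] using act_mem_component hL g⁻¹

theorem IsLagrangian.sympForm_eq_zero {L : Submodule ℂ (Vec n ℂ)} (hL : IsLagrangian L)
    {x y : Vec n ℂ} (hx : x ∈ L) (hy : y ∈ L) : sympForm x y = 0 :=
  (hL y).1 hy x hx

/-- By Cauchy–Schwarz an isotropic vector `x` of the Hermitian form on `L` satisfies `sympForm y
(star x) = 0` for all `y ∈ L`. As `L` is its own complement, `star x ∈ L`. -/
theorem hermForm_eq_zero_iff {V L : Submodule ℂ (Vec n ℂ)} (hL : L ∈ component V) {x : Vec n ℂ}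
    (hx : x ∈ L) : hermForm x = 0 ↔ x ∈ V := by
  constructor
  · intro h
    rw [← hL.2.2]
    refine ⟨hx, (hL.1 _).2 fun y hy => ?_⟩
    have := im_sq_le_of_hermForm hL.2.1 hx hy
    rw [h, mul_zero, zero_mul] at this
    exact Complex.normSq_eq_zero.1 (le_antisymm this (Complex.normSq_nonneg _))
  · intro h
    rw [← hL.2.2] at h
    rw [hermForm_eq, hL.1.sympForm_eq_zero hx h.2, Complex.zero_im, zero_div]

end Action

/-! ### The Siegel space as a set of Lagrangian subspaces -/

section Siegel

variable {q : ℕ}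

theorem mem_siegelPt {Z : Matrix (Fin q) (Fin q) ℂ} {x : Vec q ℂ} :
    x ∈ siegelPt Z ↔ ∀ i, x (Sum.inl i) = ∑ k, Z i k * x (Sum.inr k) := by
  change (fun i => x (Sum.inl i)) = Z *ᵥ (fun i => x (Sum.inr i)) ↔ _
  rw [funext_iff]
  rfl

theorem hermForm_of_mem_siegelPt {Z : Matrix (Fin q) (Fin q) ℂ} (hZ : Zᵀ = Z) {x : Vec q ℂ}
    (hx : x ∈ siegelPt Z) :
    hermForm x = (fun i => (x (Sum.inr i)).re) ⬝ᵥ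
        (Z.map Complex.im *ᵥ fun i => (x (Sum.inr i)).re) +
      (fun i => (x (Sum.inr i)).im) ⬝ᵥ (Z.map Complex.im *ᵥ fun i => (x (Sum.inr i)).im) := by
  rw [mem_siegelPt] at hx
  have hs : ∀ i k, Z i k = Z k i := fun i k => congrFun (congrFun hZ.symm i) k
  -- The contribution of `Re Z` is the sum of a symmetric times an antisymmetric expression in `i,
  -- k`.
  have h0 : ∑ i, ∑ k, (Z i k).re * ((x (Sum.inr k)).im * (x (Sum.inr i)).re -
      (x (Sum.inr k)).re * (x (Sum.inr i)).im) = 0 := by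
    have h : ∀ s : ℝ, s = -s → s = 0 := fun s hs => by linarith
    apply h
    conv_lhs => rw [Finset.sum_comm]
    simp only [← Finset.sum_neg_distrib]
    refine Finset.sum_congr rfl fun i _ => Finset.sum_congr rfl fun k _ => ?_
    rw [hs k i]
    ring
  rw [← sub_eq_zero, ← h0]
  simp only [hermForm, hx, Complex.im_sum, dotProduct, mulVec, Finset.mul_sum, Finset.sum_mul,
    ← Finset.sum_add_distrib, ← Finset.sum_sub_distrib]
  refine Finset.sum_congr rfl fun i _ => Finset.sum_congr rfl fun k _ => ?_
  simp
  ring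

theorem hermForm_nonneg_of_mem_siegelPt {Z : Matrix (Fin q) (Fin q) ℂ} (hZ : Z ∈ siegelSpace q)
    {x : Vec q ℂ} (hx : x ∈ siegelPt Z) : 0 ≤ hermForm x := by
  rw [hermForm_of_mem_siegelPt hZ.1 hx]
  have h := hZ.2.posSemidef.dotProduct_mulVec_nonneg
  simp only [star_trivial] at h
  exact add_nonneg (h _) (h _)

theorem eq_zero_of_mem_siegelPt {Z : Matrix (Fin q) (Fin q) ℂ} (hZ : Z ∈ siegelSpace q)
    {x : Vec q ℂ} (hx : x ∈ siegelPt Z) (h0 : hermForm x = 0) : x = 0 := by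
  rw [hermForm_of_mem_siegelPt hZ.1 hx] at h0
  have h := hZ.2.posSemidef.dotProduct_mulVec_nonneg
  have hp : ∀ v : Fin q → ℝ, v ≠ 0 → 0 < star v ⬝ᵥ (Z.map Complex.im *ᵥ v) :=
    fun v hv => hZ.2.dotProduct_mulVec_pos hv
  simp only [star_trivial] at h hp
  have hr : (fun i => (x (Sum.inr i)).re) = 0 := by
    by_contra hne
    linarith [hp _ hne, h fun i => (x (Sum.inr i)).im]
  have hi : (fun i => (x (Sum.inr i)).im) = 0 := by
    by_contra hne
    linarith [hp _ hne, h fun i => (x (Sum.inr i)).re]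
  have hv : ∀ i, x (Sum.inr i) = 0 := fun i => Complex.ext (congrFun hr i) (congrFun hi i)
  rw [mem_siegelPt] at hx
  ext (i | i)
  · simp [hx, hv]
  · exact hv i

theorem isLagrangian_siegelPt {Z : Matrix (Fin q) (Fin q) ℂ} (hZ : Zᵀ = Z) :
    IsLagrangian (siegelPt Z) := by
  have hs : ∀ i k, Z i k = Z k i := fun i k => congrFun (congrFun hZ.symm i) k
  intro x
  constructor
  · intro hx y hy
    rw [mem_siegelPt] at hx hy
    simp only [sympForm, hx, hy, Finset.sum_sub_distrib, Finset.sum_mul, Finset.mul_sum]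
    rw [sub_eq_zero, Finset.sum_comm]
    refine Finset.sum_congr rfl fun i _ => Finset.sum_congr rfl fun k _ => ?_
    rw [hs k i]
    ring
  · intro h
    rw [mem_siegelPt]
    intro i
    have := h (Sum.elim (fun k => Z k i) (Pi.single i 1)) (by
      rw [mem_siegelPt]
      intro k
      simp [Pi.single_apply])
    simp only [sympForm, Sum.elim_inl, Sum.elim_inr, Finset.sum_sub_distrib, Pi.single_apply,
      ite_mul, one_mul, zero_mul, Finset.sum_ite_eq', Finset.mem_univ, if_true] at this
    rw [← sub_eq_zero.1 this]
    exact Finset.sum_congr rfl fun k _ => by rw [hs k i]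

theorem siegelPt_mem_component {Z : Matrix (Fin q) (Fin q) ℂ} (hZ : Z ∈ siegelSpace q) :
    siegelPt Z ∈ component (⊥ : Submodule ℂ (Vec q ℂ)) := by
  refine ⟨isLagrangian_siegelPt hZ.1, fun x hx => hermForm_nonneg_of_mem_siegelPt hZ hx, ?_⟩
  rw [eq_bot_iff]
  rintro x ⟨hx, hx'⟩
  refine eq_zero_of_mem_siegelPt hZ hx ?_
  rw [hermForm_eq, (isLagrangian_siegelPt hZ.1).sympForm_eq_zero hx hx', Complex.zero_im, zero_div]

theorem eq_zero_of_mem_component_bot {L : Submodule ℂ (Vec q ℂ)} (hL : L ∈ component ⊥)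
    {x : Vec q ℂ} (hx : x ∈ L) (h0 : hermForm x = 0) : x = 0 :=
  (hermForm_eq_zero_iff hL hx).1 h0

theorem eq_zero_of_inr_eq_zero {L : Submodule ℂ (Vec q ℂ)} (hL : L ∈ component ⊥)
    {x : Vec q ℂ} (hx : x ∈ L) (h0 : ∀ i, x (Sum.inr i) = 0) : x = 0 :=
  eq_zero_of_mem_component_bot hL hx (by simp [hermForm, h0])

/-- If the projection of `L` to the second half of the coordinates were not onto, a nonzero linear
form `f` would vanish on its image. The vector `(f, 0)` is then orthogonal to `L`, hence in `L`, and
the Hermitian form vanishes on it, against definiteness. -/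
theorem exists_mem_of_mem_component_bot {L : Submodule ℂ (Vec q ℂ)} (hL : L ∈ component ⊥)
    (v : Fin q → ℂ) : ∃ x ∈ L, ∀ i, x (Sum.inr i) = v i := by
  set p : Submodule ℂ (Fin q → ℂ) := L.map (LinearMap.funLeft ℂ ℂ Sum.inr)
  have htop : p = ⊤ := by
    by_contra hne
    obtain ⟨f, hf0, hf⟩ := Submodule.exists_le_ker_of_lt_top p (lt_top_iff_ne_top.2 hne)
    have hfe : ∀ v, f v = ∑ i, v i * f (Pi.single i 1) := by
      intro v
      conv_lhs => rw [← Finset.univ_sum_single v, map_sum]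
      refine Finset.sum_congr rfl fun i _ => ?_
      rw [← smul_eq_mul, ← map_smul, ← Pi.single_smul, smul_eq_mul, mul_one]
    have hmem : (Sum.elim (fun i => f (Pi.single i 1)) 0 : Vec q ℂ) ∈ L := by
      rw [hL.1]
      intro y hy
      have h := hf (Submodule.mem_map_of_mem hy)
      rw [LinearMap.mem_ker, hfe] at h
      simpa [sympForm] using h
    have h0 := eq_zero_of_inr_eq_zero hL hmem (fun i => rfl)
    refine hf0 (LinearMap.ext fun v => ?_)
    rw [hfe, LinearMap.zero_apply]
    refine Finset.sum_eq_zero fun i _ => ?_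
    rw [show f (Pi.single i 1) = 0 from congrFun h0 (Sum.inl i), mul_zero]
  obtain ⟨x, hx, hxv⟩ := (Submodule.eq_top_iff'.1 htop) v
  exact ⟨x, hx, congrFun hxv⟩

/-- A point with radical 0 projects bijectively to the second half of the coordinates, so it is the
graph of a matrix `Z`. Being Lagrangian makes `Z` symmetric, and definiteness of the Hermitian form
makes `Im Z` positive definite. -/
theorem siegelPt_image (q : ℕ) :
    siegelPt '' siegelSpace q = component (⊥ : Submodule ℂ (Vec q ℂ)) := by
  refine Set.Subset.antisymm ?_ fun L hL => ?_
  · rintro _ ⟨Z, hZ, rfl⟩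
    exact siegelPt_mem_component hZ
  choose l hl hlv using fun k => exists_mem_of_mem_component_bot hL (Pi.single k 1)
  let Z : Matrix (Fin q) (Fin q) ℂ := Matrix.of fun i k => l k (Sum.inl i)
  have hLZ : siegelPt Z = L := by
    have h : ∀ x : Vec q ℂ, ∀ i, (∑ k, x (Sum.inr k) • l k) (Sum.inl i) =
        ∑ k, Z i k * x (Sum.inr k) := fun x i => by
      simp [Z, Finset.sum_apply, mul_comm]
    have h' : ∀ x : Vec q ℂ, ∀ i, (∑ k, x (Sum.inr k) • l k) (Sum.inr i) = x (Sum.inr i) :=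
      fun x i => by simp [Finset.sum_apply, hlv, Pi.single_apply]
    have hs : ∀ x : Vec q ℂ, ∑ k, x (Sum.inr k) • l k ∈ L := fun x =>
      L.sum_mem fun k _ => L.smul_mem _ (hl k)
    ext x
    rw [mem_siegelPt]
    constructor
    · intro hx
      convert hs x using 1
      ext (i | i)
      · rw [hx, h]
      · rw [h']
    · intro hx i
      have := eq_zero_of_inr_eq_zero hL (L.sub_mem hx (hs x)) (fun i => by
        rw [Pi.sub_apply, h', sub_self])
      rw [← h, ← sub_eq_zero, ← Pi.sub_apply, this, Pi.zero_apply]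
  have hsymm : Zᵀ = Z := by
    ext i k
    have := hL.1.sympForm_eq_zero (hl i) (hl k)
    simp [sympForm, hlv, Pi.single_apply] at this
    simp only [Z, transpose_apply, of_apply]
    exact sub_eq_zero.1 this
  refine ⟨Z, ⟨hsymm, ?_⟩, hLZ⟩
  refine Matrix.PosDef.of_dotProduct_mulVec_pos ?_ fun v hv => ?_
  · ext i k
    simp only [conjTranspose_apply, map_apply, star_trivial]
    rw [← hsymm, transpose_apply, hsymm]
  · obtain ⟨x, hx, hxv⟩ := exists_mem_of_mem_component_bot hL (fun i => (v i : ℂ))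
    have h := hermForm_of_mem_siegelPt hsymm (hLZ ▸ hx)
    simp only [hxv, Complex.ofReal_re, Complex.ofReal_im] at h
    rw [star_trivial]
    have h2 : hermForm x = v ⬝ᵥ (Z.map Complex.im *ᵥ v) := by
      rw [h]
      simp [dotProduct]
    rw [← h2]
    refine lt_of_le_of_ne (hL.2.1 x hx) fun h0 => hv ?_
    have := eq_zero_of_mem_component_bot hL hx h0.symm
    ext i
    simpa [this] using (hxv i).symm

end Siegel

/-! ### The standard boundary component -/

section Std

variable {n q : ℕ}

/-- The radical of the points of the standard boundary component. -/
def stdRadical (n q : ℕ) : Submodule ℂ (Vec n ℂ) where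
  carrier := {x | (∀ i : Fin n, x (Sum.inr i) = 0) ∧
    ∀ i : Fin n, (i : ℕ) < q → x (Sum.inl i) = 0}
  add_mem' {x y} hx hy :=
    ⟨fun i => by rw [Pi.add_apply, hx.1, hy.1, add_zero],
      fun i hi => by rw [Pi.add_apply, hx.2 i hi, hy.2 i hi, add_zero]⟩
  zero_mem' := ⟨fun _ => rfl, fun _ _ => rfl⟩
  smul_mem' c x hx :=
    ⟨fun i => by rw [Pi.smul_apply, hx.1, smul_zero],
      fun i hi => by rw [Pi.smul_apply, hx.2 i hi, smul_zero]⟩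

/-- The subspace `{(u, t; v, 0) | (u, v) ∈ L}` of `ℂ²ⁿ` for a subspace `L` of `ℂ^{2q}`. -/
def lift (hq : q ≤ n) (L : Submodule ℂ (Vec q ℂ)) : Submodule ℂ (Vec n ℂ) where
  carrier := {x | (∀ j : Fin n, q ≤ (j : ℕ) → x (Sum.inr j) = 0) ∧ x ∘ hermIdx hq ∈ L}
  add_mem' {x y} hx hy :=
    ⟨fun i hi => by rw [Pi.add_apply, hx.1 i hi, hy.1 i hi, add_zero], L.add_mem hx.2 hy.2⟩
  zero_mem' := ⟨fun _ _ => rfl, L.zero_mem⟩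
  smul_mem' c x hx :=
    ⟨fun i hi => by rw [Pi.smul_apply, hx.1 i hi, smul_zero], L.smul_mem c hx.2⟩

theorem mem_lift {hq : q ≤ n} {L : Submodule ℂ (Vec q ℂ)} {x : Vec n ℂ} :
    x ∈ lift hq L ↔ (∀ j : Fin n, q ≤ (j : ℕ) → x (Sum.inr j) = 0) ∧ x ∘ hermIdx hq ∈ L := Iff.rfl

theorem phi_eq_lift (hq : q ≤ n) (Z : Matrix (Fin q) (Fin q) ℂ) :
    phi hq Z = lift hq (siegelPt Z) := rfl

theorem sympForm_comp_hermIdx {R : Type} [CommRing R] (hq : q ≤ n) {x y : Vec n R}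
    (h : ∀ j : Fin n, q ≤ (j : ℕ) →
      x (Sum.inl j) * y (Sum.inr j) - x (Sum.inr j) * y (Sum.inl j) = 0) :
    sympForm (x ∘ hermIdx hq) (y ∘ hermIdx hq) = sympForm x y := by
  refine Fintype.sum_of_injective (Fin.castLE hq) (Fin.castLE_injective hq) _ _ ?_ (fun _ => rfl)
  intro j hj
  exact h j (not_lt.1 fun hlt => hj ⟨⟨j, hlt⟩, rfl⟩)

theorem sympForm_comp_of_inr (hq : q ≤ n) {x y : Vec n ℂ}
    (hx : ∀ j : Fin n, q ≤ (j : ℕ) → x (Sum.inr j) = 0)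
    (hy : ∀ j : Fin n, q ≤ (j : ℕ) → y (Sum.inr j) = 0) :
    sympForm (x ∘ hermIdx hq) (y ∘ hermIdx hq) = sympForm x y :=
  sympForm_comp_hermIdx hq fun j hj => by rw [hx j hj, hy j hj, mul_zero, zero_mul, sub_zero]

theorem hermForm_comp_of_inr (hq : q ≤ n) {x : Vec n ℂ}
    (hx : ∀ j : Fin n, q ≤ (j : ℕ) → x (Sum.inr j) = 0) :
    hermForm (x ∘ hermIdx hq) = hermForm x := by
  rw [hermForm_eq, hermForm_eq, ← sympForm_comp_of_inr hq hx (y := star x)]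
  · rfl
  · intro j hj
    rw [Pi.star_apply, hx j hj, star_zero]

/-- Extension of a vector by zero. -/
def extendZero (hq : q ≤ n) (y : Vec q ℂ) : Vec n ℂ := Function.extend (hermIdx hq) y 0

theorem extendZero_comp (hq : q ≤ n) (y : Vec q ℂ) : extendZero hq y ∘ hermIdx hq = y :=
  Function.extend_comp (hermIdx_injective hq) _ _

theorem extendZero_inr (hq : q ≤ n) (y : Vec q ℂ) (j : Fin n) (hj : q ≤ (j : ℕ)) :
    extendZero hq y (Sum.inr j) = 0 := by
  refine Function.extend_apply' _ _ _ ?_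
  rintro ⟨i | i, h⟩
  · simp [hermIdx] at h
  · have := congrArg Fin.val (Sum.inr_injective h)
    have := i.2
    simp at *
    omega

theorem single_comp_hermIdx (hq : q ≤ n) (j : Fin n) (hj : q ≤ (j : ℕ)) :
    (Pi.single (Sum.inl j) 1 : Vec n ℂ) ∘ hermIdx hq = 0 := by
  ext (i | i)
  · refine Pi.single_eq_of_ne (fun h => ?_) 1
    have := congrArg Fin.val (Sum.inl_injective h)
    have := i.2
    simp at *
    omega
  · rfl

theorem sympForm_single_inl {R : Type} [CommRing R] (j : Fin n) (x : Vec n R) :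
    sympForm (Pi.single (Sum.inl j) 1) x = x (Sum.inr j) := by
  simp [sympForm, Pi.single_apply]

theorem mem_stdRadical_iff_comp (hq : q ≤ n) {x : Vec n ℂ} :
    x ∈ stdRadical n q ↔ (∀ j : Fin n, q ≤ (j : ℕ) → x (Sum.inr j) = 0) ∧ x ∘ hermIdx hq = 0 := by
  constructor
  · rintro ⟨h1, h2⟩
    refine ⟨fun j _ => h1 j, ?_⟩
    ext (i | i)
    · exact h2 _ i.2
    · exact h1 _
  · rintro ⟨h1, h2⟩
    refine ⟨fun i => ?_, fun i hi => congrFun h2 (Sum.inl ⟨i, hi⟩)⟩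
    rcases lt_or_ge (i : ℕ) q with hi | hi
    · exact congrFun h2 (Sum.inr ⟨i, hi⟩)
    · exact h1 i hi

theorem lift_mem_component (hq : q ≤ n) {L : Submodule ℂ (Vec q ℂ)} (hL : L ∈ component ⊥) :
    lift hq L ∈ component (stdRadical n q) := by
  refine ⟨fun x => ⟨fun hx y hy => ?_, fun h => ?_⟩, fun x hx => ?_, ?_⟩
  · rw [← sympForm_comp_of_inr hq hy.1 hx.1]
    exact hL.1.sympForm_eq_zero hy.2 hx.2
  · have h1 : ∀ j : Fin n, q ≤ (j : ℕ) → x (Sum.inr j) = 0 := by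
      intro j hj
      rw [← sympForm_single_inl j x]
      refine h _ ⟨fun _ _ => rfl, ?_⟩
      rw [single_comp_hermIdx hq j hj]
      exact L.zero_mem
    refine ⟨h1, (hL.1 _).2 fun y hy => ?_⟩
    have := h (extendZero hq y) ⟨extendZero_inr hq y, (extendZero_comp hq y).symm ▸ hy⟩
    rwa [← sympForm_comp_of_inr hq (extendZero_inr hq y) h1, extendZero_comp] at this
  · rw [← hermForm_comp_of_inr hq hx.1]
    exact hL.2.1 _ hx.2
  · ext x
    rw [mem_stdRadical_iff_comp hq, ← Submodule.mem_bot ℂ (x := x ∘ hermIdx hq), ← hL.2.2]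
    constructor
    · rintro ⟨⟨h1, h2⟩, -, h4⟩
      exact ⟨h1, h2, h4⟩
    · rintro ⟨h1, h2, h3⟩
      refine ⟨⟨h1, h2⟩, fun j hj => ?_, h3⟩
      rw [Pi.star_apply, h1 j hj, star_zero]

/-- Symplectic reduction: `L` with radical `V` satisfies `V ⊆ L ⊆ V^⊥`, so it is the preimage of a
Lagrangian subspace of `V^⊥/V ≅ ℂ^{2q}`, on which the Hermitian form is definite. -/
theorem lift_image (hq : q ≤ n) :
    lift hq '' component ⊥ = component (stdRadical n q) := by
  refine Set.Subset.antisymm ?_ fun L hL => ?_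
  · rintro _ ⟨L, hL, rfl⟩
    exact lift_mem_component hq hL
  have hrad : stdRadical n q ≤ L := hL.2.2 ▸ inf_le_left
  have h1 : ∀ x ∈ L, ∀ j : Fin n, q ≤ (j : ℕ) → x (Sum.inr j) = 0 := by
    intro x hx j hj
    rw [← sympForm_single_inl j x]
    refine hL.1.sympForm_eq_zero (hrad ?_) hx
    rw [mem_stdRadical_iff_comp hq]
    exact ⟨fun _ _ => rfl, single_comp_hermIdx hq j hj⟩
  have h2 : ∀ x ∈ L, ∀ y : Vec n ℂ, (∀ j : Fin n, q ≤ (j : ℕ) → y (Sum.inr j) = 0) →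
      x ∘ hermIdx hq = y ∘ hermIdx hq → y ∈ L := by
    intro x hx y hy hxy
    rw [← sub_add_cancel y x]
    refine L.add_mem (hrad ((mem_stdRadical_iff_comp hq).2 ⟨fun j hj => ?_, ?_⟩)) hx
    · rw [Pi.sub_apply, hy j hj, h1 x hx j hj, sub_zero]
    · ext i
      have := congrFun hxy i
      simp only [Function.comp_apply] at this
      simp [this]
  set L' := L.map (LinearMap.funLeft ℂ ℂ (hermIdx hq))
  have hmem : ∀ x ∈ L, x ∘ hermIdx hq ∈ L' := fun x hx => Submodule.mem_map_of_mem hx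
  refine ⟨L', ⟨fun y => ⟨?_, fun h => ?_⟩, ?_, ?_⟩, ?_⟩
  · rintro ⟨x, hx, rfl⟩ _ ⟨z, hz, rfl⟩
    exact (sympForm_comp_of_inr hq (h1 z hz) (h1 x hx)).trans (hL.1.sympForm_eq_zero hz hx)
  · rw [← extendZero_comp hq y]
    refine hmem _ ((hL.1 _).2 fun x hx => ?_)
    rw [← sympForm_comp_of_inr hq (h1 x hx) (extendZero_inr hq y), extendZero_comp]
    exact h _ (hmem x hx)
  · rintro _ ⟨x, hx, rfl⟩
    exact (hL.2.1 x hx).trans_eq (hermForm_comp_of_inr hq (h1 x hx)).symm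
  · rw [eq_bot_iff]
    rintro _ ⟨⟨x, hx, rfl⟩, ⟨z, hz, hzx⟩⟩
    have hx' : x ∈ stdRadical n q := by
      rw [← hL.2.2]
      refine ⟨hx, h2 z hz _ (fun j hj => ?_) hzx⟩
      rw [Pi.star_apply, h1 x hx j hj, star_zero]
    exact ((mem_stdRadical_iff_comp hq).1 hx').2
  · ext x
    rw [mem_lift]
    constructor
    · rintro ⟨hx, z, hz, hzx⟩
      exact h2 z hz x hx hzx
    · exact fun hx => ⟨h1 x hx, hmem x hx⟩

theorem stdComponent_eq (hq : q ≤ n) : stdComponent n hq = component (stdRadical n q) := by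
  rw [← lift_image hq, ← siegelPt_image, Set.image_image]
  rfl

theorem lift_injective (hq : q ≤ n) : Function.Injective (lift hq) := by
  intro L L' h
  ext y
  have : ∀ L, y ∈ L ↔ extendZero hq y ∈ lift hq L := fun L => by
    rw [mem_lift, extendZero_comp, and_iff_right (extendZero_inr hq y)]
  rw [this L, this L', h]

theorem tauPt_lift (hq : q ≤ n) (L : Submodule ℂ (Vec q ℂ)) :
    tauPt (lift hq L) = lift hq (tauPt L) := by
  have h : ∀ x : Vec n ℂ, (Iminus n ℂ *ᵥ star x) ∘ hermIdx hq =
      Iminus q ℂ *ᵥ star (x ∘ hermIdx hq) := by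
    intro x
    ext (i | i) <;> simp [Iminus, fromBlocks_mulVec, neg_mulVec, hermIdx]
  have h' : ∀ (x : Vec n ℂ) (j : Fin n),
      (Iminus n ℂ *ᵥ star x) (Sum.inr j) = star (x (Sum.inr j)) := by
    intro x j
    simp [Iminus, fromBlocks_mulVec]
  ext x
  simp only [mem_tauPt, mem_lift, h, h', star_eq_zero]

end Std

/-! ### The parabolic subgroup and its Hermitian factor -/

section Parabolic

variable {n q : ℕ}

section Ring

variable {R : Type} [CommRing R]

theorem tau_coe (g : Sp n R) :
    (tau g).1 = fromBlocks g.1.toBlocks₁₁ (-g.1.toBlocks₁₂) (-g.1.toBlocks₂₁) g.1.toBlocks₂₂ := by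
  change Iminus n R * g.1 * Iminus n R = _
  conv_lhs => rw [← fromBlocks_toBlocks g.1]
  simp [Iminus, fromBlocks_multiply]

theorem tau_coe_fromBlocks {g : Sp n R} {A B C D : Matrix (Fin n) (Fin n) R}
    (h : g.1 = fromBlocks A B C D) : (tau g).1 = fromBlocks A (-B) (-C) D := by
  rw [tau_coe, h]
  simp

theorem tau_mem_parabolic {g : Sp n R} (hg : g ∈ parabolic n q R) : tau g ∈ parabolic n q R := by
  obtain ⟨h1, h2, h3, h4⟩ := hg
  change IsParabolicShape q (tau g).1
  rw [tau_coe]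
  refine ⟨fun i j hi hj => h1 i j hi hj, fun i j hj => ?_, fun i j hi => ?_,
    fun i j hi hj => h4 i j hi hj⟩
  · change -g.1 (Sum.inr i) (Sum.inl j) = 0
    rw [h2 i j hj, neg_zero]
  · change -g.1 (Sum.inr i) (Sum.inl j) = 0
    rw [h3 i j hi, neg_zero]

theorem nu_tau (hq : q ≤ n) {g : Sp n R} (hg : g ∈ parabolic n q R) :
    nu hq R ⟨tau g, tau_mem_parabolic hg⟩ = tau (nu hq R ⟨g, hg⟩) := by
  refine Subtype.ext ?_
  rw [tau_coe]
  change (tau g).1.submatrix _ _ = _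
  rw [tau_coe]
  ext (i | i) (j | j) <;> rfl

theorem mem_kerNu {hq : q ≤ n} {g : Sp n R} :
    g ∈ kerNu hq R ↔ IsParabolicShape q g.1 ∧ g.1.submatrix (hermIdx hq) (hermIdx hq) = 1 := by
  constructor
  · rintro ⟨⟨g, hg⟩, h, rfl⟩
    exact ⟨hg, congrArg Subtype.val h⟩
  · rintro ⟨hg, h⟩
    exact ⟨⟨g, hg⟩, Subtype.ext h, rfl⟩

theorem mem_kerNu_iff_nu {hq : q ≤ n} {g : Sp n R} :
    g ∈ kerNu hq R ↔ ∃ hg : g ∈ parabolic n q R, nu hq R ⟨g, hg⟩ = 1 := by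
  rw [mem_kerNu]
  constructor
  · rintro ⟨hg, h⟩
    exact ⟨hg, Subtype.ext h⟩
  · rintro ⟨hg, h⟩
    exact ⟨hg, congrArg Subtype.val h⟩

/-- The matrix of extension by zero from the coordinates of the Hermitian factor. -/
def inclMatrix (hq : q ≤ n) (R : Type) [CommRing R] : Matrix (Fin n ⊕ Fin n) (Fin q ⊕ Fin q) R :=
  (1 : Matrix (Fin n ⊕ Fin n) (Fin n ⊕ Fin n) R).submatrix id (hermIdx hq)

theorem inclMatrix_transpose_mul (hq : q ≤ n) (M : Matrix (Fin n ⊕ Fin n) (Fin n ⊕ Fin n) R) :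
    (inclMatrix hq R)ᵀ * M = M.submatrix (hermIdx hq) id := by
  rw [inclMatrix, transpose_submatrix, transpose_one]
  ext i j
  simp [Matrix.mul_apply, Matrix.one_apply]

theorem mul_inclMatrix {l : Type*} (hq : q ≤ n) (M : Matrix l (Fin n ⊕ Fin n) R) :
    M * inclMatrix hq R = M.submatrix id (hermIdx hq) := by
  ext i j
  simp [inclMatrix, Matrix.mul_apply, Matrix.one_apply]

theorem inclMatrix_transpose_mul_self (hq : q ≤ n) :
    (inclMatrix hq R)ᵀ * inclMatrix hq R = 1 := by
  rw [mul_inclMatrix, inclMatrix, transpose_submatrix, transpose_one, submatrix_submatrix]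
  exact submatrix_one _ (hermIdx_injective hq)

theorem J_mul_inclMatrix (hq : q ≤ n) :
    J (Fin n) R * inclMatrix hq R = inclMatrix hq R * J (Fin q) R := by
  rw [mul_inclMatrix]
  ext (i | i) (j | j) <;>
    simp [inclMatrix, J, Matrix.mul_apply, Fintype.sum_sum_type, Matrix.one_apply, hermIdx]
  · rw [Finset.sum_eq_single j (fun k _ hk => by simp [hk]) (by simp), if_pos rfl]
    split_ifs <;> simp
  · rw [Finset.sum_eq_single j (fun k _ hk => by simp [hk]) (by simp), if_pos rfl]

theorem inclMatrix_transpose_mul_J (hq : q ≤ n) :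
    (inclMatrix hq R)ᵀ * J (Fin n) R = J (Fin q) R * (inclMatrix hq R)ᵀ := by
  have h := congrArg Matrix.transpose (J_mul_inclMatrix (R := R) hq)
  rw [transpose_mul, transpose_mul, J_transpose, J_transpose] at h
  simpa using h

/-- The embedding of the Hermitian factor in the parabolic subgroup. -/
def embed (hq : q ≤ n) (b : Sp q R) : Sp n R :=
  ⟨1 + inclMatrix hq R * (b.1 - 1) * (inclMatrix hq R)ᵀ, by
    set P := inclMatrix hq R
    have hb := SymplecticGroup.mem_iff.1 b.2
    have h1 : Pᵀ * P = 1 := inclMatrix_transpose_mul_self hq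
    have h2 : J (Fin n) R * P = P * J (Fin q) R := J_mul_inclMatrix hq
    have h3 : Pᵀ * J (Fin n) R = J (Fin q) R * Pᵀ := inclMatrix_transpose_mul_J hq
    rw [SymplecticGroup.mem_iff, transpose_add, transpose_mul, transpose_mul, transpose_transpose,
      transpose_one]
    have e1 : P * (b.1 - 1) * Pᵀ * J (Fin n) R = P * ((b.1 - 1) * J (Fin q) R) * Pᵀ := by
      simp only [Matrix.mul_assoc, h3]
    have e2 : J (Fin n) R * (P * ((b.1 - 1)ᵀ * Pᵀ)) = P * (J (Fin q) R * (b.1 - 1)ᵀ) * Pᵀ := by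
      simp only [← Matrix.mul_assoc, h2]
    have e3 : P * ((b.1 - 1) * J (Fin q) R) * Pᵀ * (P * ((b.1 - 1)ᵀ * Pᵀ)) =
        P * ((b.1 - 1) * J (Fin q) R * (b.1 - 1)ᵀ) * Pᵀ := by
      calc _ = P * ((b.1 - 1) * J (Fin q) R) * (Pᵀ * P) * ((b.1 - 1)ᵀ * Pᵀ) := by
            simp only [Matrix.mul_assoc]
        _ = _ := by rw [h1]; simp only [Matrix.mul_assoc, Matrix.one_mul]
    rw [Matrix.add_mul, Matrix.one_mul, e1, Matrix.mul_add, Matrix.mul_one, Matrix.add_mul, e2, e3]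
    -- The left side expands to `b J ᵗb - J`.
    have e4 : (b.1 - 1) * J (Fin q) R + (J (Fin q) R * (b.1 - 1)ᵀ +
        (b.1 - 1) * J (Fin q) R * (b.1 - 1)ᵀ) = 0 := by
      rw [transpose_sub, transpose_one, Matrix.mul_sub, Matrix.mul_sub, Matrix.sub_mul,
        Matrix.sub_mul, hb, Matrix.mul_one, Matrix.mul_one, Matrix.one_mul]
      abel
    rw [add_assoc, ← Matrix.add_mul, ← Matrix.mul_add, ← Matrix.add_mul, ← Matrix.mul_add, e4]
    simp⟩

theorem embed_apply (hq : q ≤ n) (b : Sp q R) (i j : Fin n ⊕ Fin n)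
    (h : i ∉ Set.range (hermIdx hq) ∨ j ∉ Set.range (hermIdx hq)) :
    (embed hq b).1 i j = (1 : Matrix (Fin n ⊕ Fin n) (Fin n ⊕ Fin n) R) i j := by
  change (1 + inclMatrix hq R * (b.1 - 1) * (inclMatrix hq R)ᵀ :
    Matrix (Fin n ⊕ Fin n) (Fin n ⊕ Fin n) R) i j = _
  rw [Matrix.add_apply, add_eq_left]
  have h0 : ∀ i ∉ Set.range (hermIdx hq), ∀ k, inclMatrix hq R i k = 0 := fun i hi k =>
    Matrix.one_apply_ne fun hk => hi ⟨k, hk.symm⟩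
  rcases h with h | h
  · rw [Matrix.mul_assoc, Matrix.mul_apply]
    exact Finset.sum_eq_zero fun k _ => by rw [h0 i h, zero_mul]
  · rw [Matrix.mul_apply]
    exact Finset.sum_eq_zero fun k _ => by rw [transpose_apply, h0 j h, mul_zero]

theorem inl_notMem_range (hq : q ≤ n) {j : Fin n} (hj : q ≤ (j : ℕ)) :
    Sum.inl j ∉ Set.range (hermIdx hq) := by
  rintro ⟨i | i, h⟩
  · have h2 := congrArg Fin.val (Sum.inl_injective h)
    have := i.2
    simp only [Fin.val_castLE] at h2
    omega
  · simp [hermIdx] at h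

theorem inr_notMem_range (hq : q ≤ n) {j : Fin n} (hj : q ≤ (j : ℕ)) :
    Sum.inr j ∉ Set.range (hermIdx hq) := by
  rintro ⟨i | i, h⟩
  · simp [hermIdx] at h
  · have h2 := congrArg Fin.val (Sum.inr_injective h)
    have := i.2
    simp only [Fin.val_castLE] at h2
    omega

theorem embed_mem_parabolic (hq : q ≤ n) (b : Sp q R) : embed hq b ∈ parabolic n q R := by
  obtain ⟨h1, h2, h3, h4⟩ := isParabolicShape_one (n := n) (R := R) q
  refine ⟨fun i j hi hj => ?_, fun i j hj => ?_, fun i j hi => ?_, fun i j hi hj => ?_⟩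
  · rw [embed_apply hq b _ _ (.inr (inl_notMem_range hq hj)), h1 i j hi hj]
  · rw [embed_apply hq b _ _ (.inr (inl_notMem_range hq hj)), h2 i j hj]
  · rw [embed_apply hq b _ _ (.inl (inr_notMem_range hq hi)), h3 i j hi]
  · rw [embed_apply hq b _ _ (.inl (inr_notMem_range hq hi)), h4 i j hi hj]

theorem nu_embed (hq : q ≤ n) (b : Sp q R) :
    nu hq R ⟨embed hq b, embed_mem_parabolic hq b⟩ = b := by
  refine Subtype.ext ?_
  change (1 + inclMatrix hq R * (b.1 - 1) * (inclMatrix hq R)ᵀ).submatrix (hermIdx hq)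
    (hermIdx hq) = b.1
  have h : ∀ M : Matrix (Fin n ⊕ Fin n) (Fin n ⊕ Fin n) R,
      M.submatrix (hermIdx hq) (hermIdx hq) = (inclMatrix hq R)ᵀ * M * inclMatrix hq R := by
    intro M
    rw [inclMatrix_transpose_mul, mul_inclMatrix, submatrix_submatrix]
    rfl
  rw [h, Matrix.mul_add, Matrix.add_mul, Matrix.mul_one]
  calc _ = (inclMatrix hq R)ᵀ * inclMatrix hq R + (inclMatrix hq R)ᵀ * inclMatrix hq R *
        (b.1 - 1) * ((inclMatrix hq R)ᵀ * inclMatrix hq R) := by simp only [Matrix.mul_assoc]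
    _ = b.1 := by simp [inclMatrix_transpose_mul_self]

end Ring

theorem cmat_apply (g : Sp n ℤ) (i j : Fin n ⊕ Fin n) : cmat g i j = (g.1 i j : ℂ) := rfl

theorem cmat_mulVec_inr {g : Sp n ℤ} (hg : g ∈ parabolic n q ℤ) {x : Vec n ℂ}
    (hx : ∀ j : Fin n, q ≤ (j : ℕ) → x (Sum.inr j) = 0) (j : Fin n) (hj : q ≤ (j : ℕ)) :
    (cmat g *ᵥ x) (Sum.inr j) = 0 := by
  obtain ⟨h1, h2, h3, h4⟩ := hg
  change ∑ k, cmat g (Sum.inr j) k * x k = 0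
  refine Finset.sum_eq_zero fun k _ => ?_
  rcases k with k | k
  · rw [cmat_apply, h3 j k hj, Int.cast_zero, zero_mul]
  · rcases lt_or_ge (k : ℕ) q with hk | hk
    · rw [cmat_apply, h4 j k hj hk, Int.cast_zero, zero_mul]
    · rw [hx k hk, mul_zero]

theorem cmat_mulVec_comp (hq : q ≤ n) {g : Sp n ℤ} (hg : g ∈ parabolic n q ℤ) {x : Vec n ℂ}
    (hx : ∀ j : Fin n, q ≤ (j : ℕ) → x (Sum.inr j) = 0) :
    (cmat g *ᵥ x) ∘ hermIdx hq = cmat (nu hq ℤ ⟨g, hg⟩) *ᵥ (x ∘ hermIdx hq) := by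
  ext i
  refine (sum_hermIdx hq (fun k => cmat g (hermIdx hq i) k * x k) (fun k hk => ?_)
    fun k hk => by rw [hx k hk, mul_zero]).symm
  have h : g.1 (hermIdx hq i) (Sum.inl k) = 0 := by
    rcases i with i | i
    · exact hg.1 _ k i.2 hk
    · exact hg.2.1 _ k hk
  rw [cmat_apply, h, Int.cast_zero, zero_mul]

theorem nu_inv (hq : q ≤ n) {g : Sp n ℤ} (hg : g ∈ parabolic n q ℤ)
    (hg' : g⁻¹ ∈ parabolic n q ℤ) : (nu hq ℤ ⟨g, hg⟩)⁻¹ = nu hq ℤ ⟨g⁻¹, hg'⟩ := by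
  rw [inv_eq_iff_mul_eq_one, ← map_mul, ← map_one (nu hq ℤ)]
  congr 1
  exact Subtype.ext (mul_inv_cancel g)

/-- `P_q` acts on `F_q` through `ν`; in particular `ker ν` acts trivially there. -/
theorem act_lift (hq : q ≤ n) {g : Sp n ℤ} (hg : g ∈ parabolic n q ℤ)
    (L : Submodule ℂ (Vec q ℂ)) :
    act g (lift hq L) = lift hq (act (nu hq ℤ ⟨g, hg⟩) L) := by
  have hg' : g⁻¹ ∈ parabolic n q ℤ := inv_mem hg
  ext x
  rw [mem_act, mem_lift, mem_lift, mem_act, nu_inv hq hg hg']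
  constructor
  · rintro ⟨h1, h2⟩
    have h3 := cmat_mulVec_inr hg h1
    rw [cmat_mulVec_inv] at h3
    refine ⟨h3, ?_⟩
    rwa [← cmat_mulVec_comp hq hg' h3]
  · rintro ⟨h1, h2⟩
    refine ⟨cmat_mulVec_inr hg' h1, ?_⟩
    rwa [cmat_mulVec_comp hq hg' h1]

theorem stdRadical_eq_lift (hq : q ≤ n) : stdRadical n q = lift hq ⊥ := by
  ext x
  rw [mem_stdRadical_iff_comp hq, mem_lift, Submodule.mem_bot]

theorem act_bot (g : Sp n ℤ) : act g (⊥ : Submodule ℂ (Vec n ℂ)) = ⊥ := Submodule.map_bot _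

theorem act_stdRadical (hq : q ≤ n) {g : Sp n ℤ} (hg : g ∈ parabolic n q ℤ) :
    act g (stdRadical n q) = stdRadical n q := by
  rw [stdRadical_eq_lift hq, act_lift hq hg, act_bot]

theorem cmat_mulVec_single (g : Sp n ℤ) (j i : Fin n ⊕ Fin n) :
    (cmat g *ᵥ Pi.single j 1) i = (g.1 i j : ℂ) := by
  rw [mulVec_single_one]
  rfl

/-- Stability of the radical concerns the columns `inl j` with `q ≤ j` and yields two of the
vanishing blocks. The other two are the same statement for `g⁻¹`, transported by the formula for the
inverse of a symplectic matrix. -/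
theorem mem_parabolic_of_act_stdRadical {g : Sp n ℤ} (hg : act g (stdRadical n q) = stdRadical n q) :
    g ∈ parabolic n q ℤ := by
  have hg' : act g⁻¹ (stdRadical n q) = stdRadical n q := by
    conv_lhs => rw [← hg]
    exact act_inv_act _ _
  have h : ∀ g : Sp n ℤ, act g (stdRadical n q) = stdRadical n q → ∀ j : Fin n, q ≤ (j : ℕ) →
      (∀ i : Fin n, g.1 (Sum.inr i) (Sum.inl j) = 0) ∧
      ∀ i : Fin n, (i : ℕ) < q → g.1 (Sum.inl i) (Sum.inl j) = 0 := by
    intro g hg j hj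
    have hs : (Pi.single (Sum.inl j) 1 : Vec n ℂ) ∈ stdRadical n q := by
      refine ⟨fun i => rfl, fun i hi => Pi.single_eq_of_ne (fun h => ?_) _⟩
      rw [Sum.inl_injective h] at hi
      omega
    have hm := hg ▸ mulVec_mem_act (g := g).2 hs
    refine ⟨fun i => ?_, fun i hi => ?_⟩
    · have := hm.1 i
      rw [cmat_mulVec_single] at this
      exact_mod_cast this
    · have := hm.2 i hi
      rw [cmat_mulVec_single] at this
      exact_mod_cast this
  refine ⟨fun i j hi hj => (h g hg j hj).2 i hi, fun i j hj => (h g hg j hj).1 i,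
    fun i j hi => ?_, fun i j hi hj => ?_⟩
  · have := (h _ hg' i hi).1 j
    rwa [coe_inv_inr_inl, neg_eq_zero] at this
  · have := (h _ hg' i hi).2 j hj
    rwa [coe_inv_inl_inl] at this

theorem act_lift_of_mem_kerNu (hq : q ≤ n) {g : Sp n ℤ} (hg : g ∈ kerNu hq ℤ)
    (L : Submodule ℂ (Vec q ℂ)) : act g (lift hq L) = lift hq L := by
  obtain ⟨hg, h⟩ := mem_kerNu_iff_nu.1 hg
  rw [act_lift hq hg, h, act_one]

theorem act_of_mem_kerNu (hq : q ≤ n) {g : Sp n ℤ} (hg : g ∈ kerNu hq ℤ)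
    {L : Submodule ℂ (Vec n ℂ)} (hL : L ∈ stdComponent n hq) : act g L = L := by
  obtain ⟨Z, -, rfl⟩ := hL
  rw [phi_eq_lift, act_lift_of_mem_kerNu hq hg]

end Parabolic

/-! ### Integral symplectic matrices congruent to 1 modulo 4 with a fixed point in `𝔥_q` -/

section Rigidity

variable {q : ℕ}

/-- The symplectic complement of `L + L̄` is `L ∩ L̄ = 0`. -/
theorem exists_add_star_of_mem_component_bot {L : Submodule ℂ (Vec q ℂ)} (hL : L ∈ component ⊥)
    (z : Vec q ℂ) : ∃ x ∈ L, ∃ y ∈ L, z = x + star y := by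
  have htop : L ⊔ conj L = ⊤ := by
    by_contra hne
    obtain ⟨f, hf0, hf⟩ := Submodule.exists_le_ker_of_lt_top _ (lt_top_iff_ne_top.2 hne)
    obtain ⟨w, hw⟩ := exists_sympForm_eq f
    have h1 : w ∈ L := (hL.1 _).2 fun y hy => by
      rw [← hw]
      exact hf (Submodule.mem_sup_left hy)
    have h2 : star w ∈ L := (hL.1 _).2 fun y hy => by
      have : f (star y) = 0 := hf (Submodule.mem_sup_right (by rwa [mem_conj, star_star]))
      rw [← star_star y, sympForm_star, ← hw, this, star_zero]
    have h3 : w ∈ (⊥ : Submodule ℂ (Vec q ℂ)) := hL.2.2 ▸ ⟨h1, h2⟩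
    rw [Submodule.mem_bot] at h3
    exact hf0 (LinearMap.ext fun x => by rw [hw, h3, sympForm_zero_right, LinearMap.zero_apply])
  obtain ⟨x, hx, y, hy, h⟩ := Submodule.mem_sup.1 (htop ▸ Submodule.mem_top : z ∈ L ⊔ conj L)
  exact ⟨x, hx, star y, hy, by rw [star_star, h]⟩

variable {ρ : Sp q ℤ} {X : Matrix (Fin q ⊕ Fin q) (Fin q ⊕ Fin q) ℤ}

/-- The complex matrix of an integral matrix. -/
abbrev castMat (X : Matrix (Fin q ⊕ Fin q) (Fin q ⊕ Fin q) ℤ) :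
    Matrix (Fin q ⊕ Fin q) (Fin q ⊕ Fin q) ℂ := X.map (Int.castRingHom ℂ)

theorem castMat_pow (X : Matrix (Fin q ⊕ Fin q) (Fin q ⊕ Fin q) ℤ) (k : ℕ) :
    castMat (X ^ k) = castMat X ^ k :=
  map_pow (Int.castRingHom ℂ).mapMatrix X k

theorem star_castMat_mulVec (x : Vec q ℂ) : star (castMat X *ᵥ x) = castMat X *ᵥ star x := by
  ext i
  simp [mulVec, dotProduct]

theorem cmat_mulVec_of_eq (hρ : ρ.1 = 1 + (4 : ℤ) • X) (x : Vec q ℂ) :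
    cmat ρ *ᵥ x = x + (4 : ℂ) • (castMat X *ᵥ x) := by
  have : cmat ρ = 1 + (4 : ℂ) • castMat X := by
    ext i j
    rw [cmat_apply, hρ, Matrix.add_apply, Matrix.add_apply, Matrix.smul_apply, Matrix.smul_apply]
    simp [Matrix.one_apply, apply_ite]
  rw [this, add_mulVec, one_mulVec, smul_mulVec]

theorem castMat_mulVec_mem (hρ : ρ.1 = 1 + (4 : ℤ) • X) {L : Submodule ℂ (Vec q ℂ)}
    (hfix : act ρ L = L) {x : Vec q ℂ} (hx : x ∈ L) : castMat X *ᵥ x ∈ L := by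
  have h : cmat ρ *ᵥ x ∈ L := by
    have := (mulVec_mem_act (g := ρ)).2 hx
    rwa [hfix] at this
  rw [cmat_mulVec_of_eq hρ, L.add_mem_iff_right hx] at h
  simpa [smul_smul] using L.smul_mem (4⁻¹ : ℂ) h

theorem castMat_pow_mulVec_mem (hρ : ρ.1 = 1 + (4 : ℤ) • X) {L : Submodule ℂ (Vec q ℂ)}
    (hfix : act ρ L = L) {x : Vec q ℂ} (hx : x ∈ L) (k : ℕ) : castMat X ^ k *ᵥ x ∈ L := by
  induction k with
  | zero => simpa using hx
  | succ k ih =>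
    rw [pow_succ', ← mulVec_mulVec]
    exact castMat_mulVec_mem hρ hfix ih

/-- Expansion of the invariance of the Hermitian form under `ρ = 1 + 4X`. -/
theorem hermForm_castMat_relation (hρ : ρ.1 = 1 + (4 : ℤ) • X) (x : Vec q ℂ) :
    4 * hermForm (castMat X *ᵥ x) + (sympForm x (star (castMat X *ᵥ x))).im = 0 := by
  have h := hermForm_cmat ρ x
  rw [cmat_mulVec_of_eq hρ, hermForm_add_smul] at h
  simp at h
  linarith

/-- `ρ` acts on `L` as a unitary map, so `X = (ρ - 1)/4` has operator norm at most `1/2`. -/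
theorem hermForm_castMat_le (hρ : ρ.1 = 1 + (4 : ℤ) • X) {L : Submodule ℂ (Vec q ℂ)}
    (hL : L ∈ component ⊥) (hfix : act ρ L = L) {x : Vec q ℂ} (hx : x ∈ L) :
    hermForm (castMat X *ᵥ x) ≤ 1 / 4 * hermForm x := by
  have h := hermForm_castMat_relation hρ x
  -- The vector `x + 2Xx` is the midpoint of `x` and `ρx`; by the relation above its Hermitian norm
  -- is that of `x` minus four times that of `Xx`.
  have h2 := hL.2.1 _ (L.add_mem hx (L.smul_mem 2 (castMat_mulVec_mem hρ hfix hx)))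
  rw [hermForm_add_smul] at h2
  simp at h2
  linarith

theorem hermForm_castMat_pow_le (hρ : ρ.1 = 1 + (4 : ℤ) • X) {L : Submodule ℂ (Vec q ℂ)}
    (hL : L ∈ component ⊥) (hfix : act ρ L = L) {x : Vec q ℂ} (hx : x ∈ L) (k : ℕ) :
    hermForm (castMat X ^ k *ᵥ x) ≤ (1 / 4) ^ k * hermForm x := by
  induction k with
  | zero => simp
  | succ k ih =>
    rw [pow_succ', ← mulVec_mulVec, pow_succ', mul_assoc]
    exact (hermForm_castMat_le hρ hL hfix (castMat_pow_mulVec_mem hρ hfix hx k)).trans (by gcongr)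

open Filter Topology in
theorem tendsto_sympForm_star (hρ : ρ.1 = 1 + (4 : ℤ) • X) {L : Submodule ℂ (Vec q ℂ)}
    (hL : L ∈ component ⊥) (hfix : act ρ L = L) {x z : Vec q ℂ} (hx : x ∈ L) (hz : z ∈ L) :
    Tendsto (fun k : ℕ => sympForm z (star (castMat X ^ k *ᵥ x))) atTop (𝓝 0) := by
  have h0 : Tendsto (fun k : ℕ => ((1 / 4 : ℝ) ^ k * hermForm x) * (4 * hermForm z)) atTop
      (𝓝 0) := by
    have := ((tendsto_pow_atTop_nhds_zero_of_lt_one (r := (1 / 4 : ℝ)) (by norm_num)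
      (by norm_num)).mul_const (hermForm x)).mul_const (4 * hermForm z)
    simpa using this
  have h1 : Tendsto (fun k : ℕ => ‖sympForm z (star (castMat X ^ k *ᵥ x))‖ ^ 2) atTop (𝓝 0) := by
    refine squeeze_zero (fun _ => by positivity) (fun k => ?_) h0
    rw [← Complex.normSq_eq_norm_sq]
    refine (im_sq_le_of_hermForm hL.2.1 (castMat_pow_mulVec_mem hρ hfix hx k) hz).trans ?_
    have := mul_le_mul_of_nonneg_right (hermForm_castMat_pow_le hρ hL hfix hx k)
      (mul_nonneg zero_le_four (hL.2.1 z hz))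
    linarith
  rw [tendsto_zero_iff_norm_tendsto_zero]
  have := h1.sqrt
  simpa using this

open Filter Topology in
-- Split both vectors along `L + L̄`. The terms within `L` or within `L̄` vanish because these are
-- isotropic and stable under `X`; the mixed terms are bounded by Cauchy–Schwarz and the
-- contraction.
theorem tendsto_sympForm (hρ : ρ.1 = 1 + (4 : ℤ) • X) {L : Submodule ℂ (Vec q ℂ)}
    (hL : L ∈ component ⊥) (hfix : act ρ L = L) (x z : Vec q ℂ) :
    Tendsto (fun k : ℕ => sympForm z (castMat X ^ k *ᵥ x)) atTop (𝓝 0) := by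
  obtain ⟨x₁, hx₁, x₂, hx₂, rfl⟩ := exists_add_star_of_mem_component_bot hL x
  obtain ⟨z₁, hz₁, z₂, hz₂, rfl⟩ := exists_add_star_of_mem_component_bot hL z
  have h1 := tendsto_sympForm_star hρ hL hfix hx₂ hz₁
  have h2 := (tendsto_sympForm_star hρ hL hfix hx₁ hz₂).star
  rw [star_zero] at h2
  have h3 := h1.add h2
  rw [add_zero] at h3
  refine h3.congr fun k => ?_
  have e1 : sympForm z₁ (castMat X ^ k *ᵥ x₁) = 0 :=
    hL.1.sympForm_eq_zero hz₁ (castMat_pow_mulVec_mem hρ hfix hx₁ k)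
  have e2 : sympForm z₂ (castMat X ^ k *ᵥ x₂) = 0 :=
    hL.1.sympForm_eq_zero hz₂ (castMat_pow_mulVec_mem hρ hfix hx₂ k)
  have e3 : castMat X ^ k *ᵥ star x₂ = star (castMat X ^ k *ᵥ x₂) := by
    rw [← castMat_pow, star_castMat_mulVec]
  rw [mulVec_add, e3, sympForm_add_left, sympForm_add_right, sympForm_add_right, e1,
    sympForm_star z₂, e2, ← sympForm_star, star_star, star_zero, zero_add, add_zero]

/-- Each coordinate is, up to sign, a pairing with a standard basis vector, so the entries of `X ^
k` tend to 0. They are integers, so they vanish eventually. -/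
theorem exists_pow_eq_zero (hρ : ρ.1 = 1 + (4 : ℤ) • X) {L : Submodule ℂ (Vec q ℂ)}
    (hL : L ∈ component ⊥) (hfix : act ρ L = L) : ∃ k, X ^ k = 0 := by
  have h : ∀ i j, ∀ᶠ k in Filter.atTop, (X ^ k) i j = 0 := by
    intro i j
    have key : ∀ z : Vec q ℂ, (∀ x, ‖x i‖ = ‖sympForm z x‖) →
        ∀ᶠ k in Filter.atTop, (X ^ k) i j = 0 := by
      intro z hz
      have := (tendsto_zero_iff_norm_tendsto_zero.1
        (tendsto_sympForm hρ hL hfix (Pi.single j 1) z)).eventually (gt_mem_nhds zero_lt_one)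
      filter_upwards [this] with k hk
      rw [← hz, mulVec_single_one, ← castMat_pow] at hk
      change ‖(((X ^ k) i j : ℤ) : ℂ)‖ < 1 at hk
      rw [Complex.norm_intCast] at hk
      exact Int.abs_lt_one_iff.1 (by exact_mod_cast hk)
    rcases i with i | i
    · refine key (Pi.single (Sum.inr i) 1) fun x => ?_
      simp [sympForm, Pi.single_apply]
    · refine key (Pi.single (Sum.inl i) 1) fun x => ?_
      simp [sympForm, Pi.single_apply]
  obtain ⟨k, hk⟩ := (Filter.eventually_all.2 fun i => Filter.eventually_all.2 (h i)).exists
  exact ⟨k, Matrix.ext hk⟩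

/-- A unipotent unitary map is trivial. If `X²x = 0`, comparing the Hermitian norms of `x + Xx` and
of its image `x + 5Xx` under `ρ`, together with the relation for `x`, forces the norm of `Xx` to be
0. -/
theorem castMat_mulVec_eq_zero_of_sq (hρ : ρ.1 = 1 + (4 : ℤ) • X) {L : Submodule ℂ (Vec q ℂ)}
    (hL : L ∈ component ⊥) (hfix : act ρ L = L) {x : Vec q ℂ} (hx : x ∈ L)
    (h0 : castMat X *ᵥ (castMat X *ᵥ x) = 0) : castMat X *ᵥ x = 0 := by
  refine eq_zero_of_mem_component_bot hL (castMat_mulVec_mem hρ hfix hx) ?_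
  have h1 := hermForm_castMat_relation hρ x
  have h2 := hermForm_cmat ρ (x + (1 : ℂ) • castMat X *ᵥ x)
  have h3 : cmat ρ *ᵥ (x + (1 : ℂ) • castMat X *ᵥ x) = x + (5 : ℂ) • castMat X *ᵥ x := by
    rw [cmat_mulVec_of_eq hρ, mulVec_add, one_smul, h0, add_zero]
    module
  rw [h3, hermForm_add_smul, hermForm_add_smul] at h2
  simp [Complex.normSq_apply] at h2
  linarith

/-- `X` is nilpotent because it is integral and contracting, and unitarity of `ρ` on `L` excludes
nonzero nilpotents. So `X` kills `L`, hence `L̄` since it is real, hence everything. -/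
theorem eq_one_of_act_eq (hρ : ρ.1 = 1 + (4 : ℤ) • X) {L : Submodule ℂ (Vec q ℂ)}
    (hL : L ∈ component ⊥) (hfix : act ρ L = L) : ρ = 1 := by
  have hpow : ∀ k : ℕ, ∀ x ∈ L, castMat X ^ (k + 1) *ᵥ x = 0 → castMat X *ᵥ x = 0 := by
    intro k
    induction k with
    | zero => intro x _ h; simpa using h
    | succ k ih =>
      intro x hx h
      refine ih x hx ?_
      rw [pow_succ', ← mulVec_mulVec]
      refine castMat_mulVec_eq_zero_of_sq hρ hL hfix (castMat_pow_mulVec_mem hρ hfix hx k) ?_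
      rwa [mulVec_mulVec, mulVec_mulVec, mul_assoc, ← pow_succ', ← pow_succ']
  obtain ⟨k, hk⟩ := exists_pow_eq_zero hρ hL hfix
  have hLz : ∀ x ∈ L, castMat X *ᵥ x = 0 := fun x hx => by
    refine hpow k x hx ?_
    rw [← castMat_pow, pow_succ', hk, mul_zero]
    simp [castMat]
  have hX : X = 0 := by
    ext i j
    obtain ⟨x, hx, y, hy, hxy⟩ := exists_add_star_of_mem_component_bot hL (Pi.single j 1)
    have : castMat X *ᵥ Pi.single j 1 = 0 := by
      rw [hxy, mulVec_add, hLz x hx, ← star_castMat_mulVec, hLz y hy, star_zero, add_zero]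
    rw [mulVec_single_one] at this
    have := congrFun this i
    simpa using this
  refine Subtype.ext ?_
  rw [hρ, hX, smul_zero, add_zero]
  rfl

end Rigidity

/-! ### Lagrangian sublattices of `ℤ²ⁿ` -/

section Lattice

variable {n : ℕ}

theorem free_quotient_of_saturated {M : Type*} [AddCommGroup M] [Module.Finite ℤ M]
    (N : Submodule ℤ M) (h : ∀ c : ℤ, c ≠ 0 → ∀ x, c • x ∈ N → x ∈ N) :
    Module.Free ℤ (M ⧸ N) := by
  have : Module.IsTorsionFree ℤ (M ⧸ N) := by
    refine Module.IsTorsionFree.of_smul_eq_zero fun c x hx => ?_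
    obtain ⟨x, rfl⟩ := Submodule.Quotient.mk_surjective N x
    rw [← Submodule.Quotient.mk_smul, Submodule.Quotient.mk_eq_zero] at hx
    rw [Submodule.Quotient.mk_eq_zero]
    by_cases hc : c = 0
    · exact .inl hc
    · exact .inr (h c hc x hx)
  exact Module.free_of_finite_type_torsion_free'

/-- A subgroup of `ℤ²ⁿ` that is its own orthogonal complement for the symplectic form. -/
def IsLagrangianLattice (Λ : Submodule ℤ (Vec n ℤ)) : Prop :=
  ∀ x, x ∈ Λ ↔ ∀ y ∈ Λ, sympForm y x = 0

theorem IsLagrangianLattice.saturated {Λ : Submodule ℤ (Vec n ℤ)} (hΛ : IsLagrangianLattice Λ)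
    (c : ℤ) (hc : c ≠ 0) (x : Vec n ℤ) (hx : c • x ∈ Λ) : x ∈ Λ := by
  rw [hΛ] at hx ⊢
  intro y hy
  have := hx y hy
  rw [sympForm_smul_right] at this
  exact (mul_eq_zero.1 this).resolve_left hc

/-- A Lagrangian lattice is saturated, hence a direct summand. The coordinate forms of a basis
therefore extend to `ℤ²ⁿ`, where the unimodular symplectic form represents them. -/
theorem IsLagrangianLattice.exists_dual {ι : Type*} [DecidableEq ι]
    {Λ : Submodule ℤ (Vec n ℤ)} (hΛ : IsLagrangianLattice Λ) (b : Module.Basis ι ℤ Λ) :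
    ∃ y : ι → Vec n ℤ, ∀ i j, sympForm (b i : Vec n ℤ) (y j) = if i = j then 1 else 0 := by
  have := free_quotient_of_saturated Λ hΛ.saturated
  let B := b.sumQuot (Module.Free.chooseBasis ℤ (Vec n ℤ ⧸ Λ))
  choose y hy using fun j => exists_sympForm_eq (B.coord (Sum.inl j))
  refine ⟨y, fun i j => ?_⟩
  rw [← hy, ← Module.Basis.sumQuot_inl b (Module.Free.chooseBasis ℤ (Vec n ℤ ⧸ Λ)) i]
  change B.repr (B (Sum.inl i)) (Sum.inl j) = _
  rw [B.repr_self, Finsupp.single_apply]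
  simp only [Sum.inl.injEq]

/-- Pairing with the basis maps `ℤ²ⁿ` onto `ℤ^ι`, by the dual vectors, with kernel `Λ`, so `2n = 2
|ι|`. -/
theorem IsLagrangianLattice.card_basis {ι : Type*} [Fintype ι] {Λ : Submodule ℤ (Vec n ℤ)}
    (hΛ : IsLagrangianLattice Λ) (b : Module.Basis ι ℤ Λ) : Fintype.card ι = n := by
  classical
  obtain ⟨y, hy⟩ := hΛ.exists_dual b
  let f : Vec n ℤ →ₗ[ℤ] ι → ℤ := LinearMap.pi fun i => sympBilin n ℤ (b i : Vec n ℤ)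
  have hf : ∀ x i, f x i = sympForm (b i : Vec n ℤ) x := fun _ _ => rfl
  have hker : f.ker = Λ := by
    ext x
    rw [LinearMap.mem_ker, hΛ]
    constructor
    · intro h z hz
      have hsub : Λ ≤ ((sympBilin n ℤ).flip x).ker := by
        have hsp : Submodule.span ℤ (Set.range fun i => (b i : Vec n ℤ)) = Λ := by
          have := congrArg (Submodule.map Λ.subtype) b.span_eq
          rwa [Submodule.map_span, Submodule.map_top, Submodule.range_subtype,
            ← Set.range_comp] at this
        rw [← hsp, Submodule.span_le]
        rintro _ ⟨i, rfl⟩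
        exact congrFun h i
      exact hsub hz
    · intro h
      ext i
      exact h _ (b i).2
  have hsurj : Function.Surjective f := fun c => by
    refine ⟨∑ j, c j • y j, ?_⟩
    ext i
    rw [hf, ← sympBilin_apply]
    simp only [map_sum, map_smul, sympBilin_apply, hy, smul_eq_mul, mul_ite, mul_one, mul_zero,
      Finset.sum_ite_eq, Finset.mem_univ, if_true]
  have h1 := Submodule.finrank_quotient_add_finrank f.ker
  rw [(f.quotKerEquivOfSurjective hsurj).finrank_eq, hker, Module.finrank_eq_card_basis b,
    Module.finrank_fintype_fun_eq_card, Module.finrank_fintype_fun_eq_card, Fintype.card_sum,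
    Fintype.card_fin] at h1
  omega

/-- Isotropic dual vectors of a basis of a Lagrangian lattice. -/
theorem IsLagrangianLattice.exists_isotropic_dual {Λ : Submodule ℤ (Vec n ℤ)}
    (hΛ : IsLagrangianLattice Λ) (b : Module.Basis (Fin n) ℤ Λ) :
    ∃ y : Fin n → Vec n ℤ, (∀ i j, sympForm (b i : Vec n ℤ) (y j) = if i = j then 1 else 0) ∧
      ∀ i j, sympForm (y i) (y j) = 0 := by
  obtain ⟨y, hy⟩ := hΛ.exists_dual b
  have hb : ∀ i j, sympForm (b i : Vec n ℤ) (b j : Vec n ℤ) = 0 := fun i j =>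
    (hΛ _).1 (b j).2 _ (b i).2
  have hy' : ∀ i j, sympForm (y j) (b i : Vec n ℤ) = if i = j then -1 else 0 := fun i j => by
    rw [sympForm_swap, hy]
    split_ifs <;> simp
  -- Subtracting multiples of the `b k` does not affect the pairings with `b`. The full error
  -- `sympForm (y j) (y k)` is corrected in the vector of smaller index only, which avoids halving
  -- it.
  let c : Fin n → Fin n → ℤ := fun k j => if j < k then sympForm (y j) (y k) else 0
  refine ⟨fun j => y j - ∑ k, c k j • (b k : Vec n ℤ), fun i j => ?_, fun i j => ?_⟩
  · rw [← sympBilin_apply]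
    simp only [map_sub, map_sum, map_smul, sympBilin_apply, hb, hy, smul_zero,
      Finset.sum_const_zero, sub_zero]
  · rw [← sympBilin_apply]
    simp only [map_sub, map_sum, map_smul, LinearMap.sub_apply, LinearMap.sum_apply,
      LinearMap.smul_apply, sympBilin_apply, hb, hy, hy', smul_eq_mul, mul_ite, mul_zero, mul_one,
      Finset.sum_const_zero, Finset.sum_ite_eq', Finset.mem_univ, if_true, c]
    rcases lt_trichotomy i j with h | h | h
    · simp [h, h.not_gt]
    · simp [h, sympForm_self]
    · simp [h, h.not_gt, sympForm_swap (y i) (y j)]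

/-- The symplectic matrix with given columns. -/
theorem exists_symplectic_of_columns {b y : Fin n → Vec n ℤ}
    (hb : ∀ i j, sympForm (b i) (b j) = 0) (hy : ∀ i j, sympForm (y i) (y j) = 0)
    (hby : ∀ i j, sympForm (b i) (y j) = if i = j then 1 else 0) :
    ∃ g : Sp n ℤ, ∀ i, g.1.col (Sum.inl i) = b i ∧ g.1.col (Sum.inr i) = y i := by
  refine ⟨⟨Matrix.of fun k i => Sum.elim b y i k, mem_symplecticGroup_of_col ?_⟩,
    fun i => ⟨rfl, rfl⟩⟩
  have hyb : ∀ i j, sympForm (y i) (b j) = if i = j then -1 else 0 := fun i j => by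
    rw [sympForm_swap, hby]
    split_ifs with h h' h' <;> simp_all
  rintro (i | i) (j | j)
  · exact (hb i j).trans (by simp [J])
  · exact (hby i j).trans (by simp [J, Matrix.one_apply])
  · exact (hyb i j).trans (by simp [J, Matrix.one_apply]; split_ifs <;> simp)
  · exact (hy i j).trans (by simp [J])

/-- A maximal isotropic sublattice exists by Noetherianity. It is Lagrangian, since adjoining a
vector orthogonal to it keeps it isotropic. -/
theorem exists_isLagrangianLattice_ge (N : Submodule ℤ (Vec n ℤ))
    (hN : ∀ x ∈ N, ∀ y ∈ N, sympForm x y = 0) : ∃ Λ, N ≤ Λ ∧ IsLagrangianLattice Λ := by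
  obtain ⟨Λ, ⟨hNΛ, hiso⟩, hmax⟩ := exists_maximal_of_wellFoundedGT
    (fun Λ : Submodule ℤ (Vec n ℤ) => N ≤ Λ ∧ ∀ x ∈ Λ, ∀ y ∈ Λ, sympForm x y = 0) ⟨N, le_rfl, hN⟩
  refine ⟨Λ, hNΛ, fun x => ⟨fun hx y hy => hiso y hy x hx, fun h => ?_⟩⟩
  have hle : Λ ≤ Λ ⊔ Submodule.span ℤ {x} := le_sup_left
  refine hmax ⟨hNΛ.trans hle, ?_⟩ hle (Submodule.mem_sup_right (Submodule.mem_span_singleton_self x))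
  intro u hu v hv
  obtain ⟨u, hu', _, hc, rfl⟩ := Submodule.mem_sup.1 hu
  obtain ⟨c, rfl⟩ := Submodule.mem_span_singleton.1 hc
  obtain ⟨v, hv', _, hd, rfl⟩ := Submodule.mem_sup.1 hv
  obtain ⟨d, rfl⟩ := Submodule.mem_span_singleton.1 hd
  simp only [sympForm_add_left, sympForm_add_right, sympForm_smul_left, sympForm_smul_right,
    hiso u hu' v hv', h u hu', sympForm_self, sympForm_swap v x, h v hv']
  simp

/-! ### Rational isotropic subspaces -/

/-- The integral points of a rational subspace. -/
def integralPoints (W : Submodule ℚ (Vec n ℚ)) : Submodule ℤ (Vec n ℤ) :=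
  (W.restrictScalars ℤ).comap ((Algebra.linearMap ℤ ℚ).compLeft (Fin n ⊕ Fin n))

theorem mem_integralPoints {W : Submodule ℚ (Vec n ℚ)} {x : Vec n ℤ} :
    x ∈ integralPoints W ↔ (fun i => (x i : ℚ)) ∈ W := Iff.rfl

theorem integralPoints_saturated (W : Submodule ℚ (Vec n ℚ)) (c : ℤ) (hc : c ≠ 0) (x : Vec n ℤ)
    (hx : c • x ∈ integralPoints W) : x ∈ integralPoints W := by
  rw [mem_integralPoints] at hx ⊢
  have hc' : (c : ℚ) ≠ 0 := Int.cast_ne_zero.2 hc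
  rw [← W.smul_mem_iff hc']
  convert hx using 1
  ext i
  simp

theorem sympForm_intCast {R : Type} [CommRing R] (x y : Vec n ℤ) :
    sympForm (fun i => (x i : R)) (fun i => (y i : R)) = (sympForm x y : ℤ) := by
  simp [sympForm]

theorem exists_integral_multiple {W : Submodule ℚ (Vec n ℚ)} {w : Vec n ℚ} (hw : w ∈ W) :
    ∃ d : ℤ, d ≠ 0 ∧ ∃ x ∈ integralPoints W, ∀ i, (x i : ℚ) = d * w i := by
  obtain ⟨d, hd⟩ := IsLocalization.exist_integer_multiples_of_finite (nonZeroDivisors ℤ) w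
  choose x hx using hd
  have hx' : ∀ i, (x i : ℚ) = (d : ℤ) * w i := fun i => by
    have := hx i
    rw [zsmul_eq_mul] at this
    exact this
  refine ⟨d, nonZeroDivisors.coe_ne_zero d, x, ?_, hx'⟩
  rw [mem_integralPoints]
  convert W.smul_mem ((d : ℤ) : ℚ) hw using 1
  ext i
  exact hx' i

/-- Clearing denominators shows that a `ℤ`-basis of the integral points is a `ℚ`-basis of `W`. -/
theorem card_basis_integralPoints {κ : Type*} [Fintype κ] {W : Submodule ℚ (Vec n ℚ)}
    (b : Module.Basis κ ℤ (integralPoints W)) : Fintype.card κ = Module.finrank ℚ W := by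
  let f : Vec n ℤ →ₗ[ℤ] Vec n ℚ := (Algebra.linearMap ℤ ℚ).compLeft (Fin n ⊕ Fin n)
  have hf : ∀ x i, f x i = (x i : ℚ) := fun _ _ => rfl
  have hinj : Function.Injective f := fun x y h => by
    ext i
    have := congrFun h i
    rw [hf, hf] at this
    exact_mod_cast this
  let v : κ → Vec n ℚ := fun k => f (b k : Vec n ℤ)
  have hli : LinearIndependent ℚ v := by
    rw [← LinearIndependent.iff_fractionRing ℤ ℚ]
    exact b.linearIndependent.map' (f ∘ₗ (integralPoints W).subtype)
      (LinearMap.ker_eq_bot.2 (hinj.comp Subtype.val_injective))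
  have hspan : Submodule.span ℚ (Set.range v) = W := by
    refine le_antisymm (Submodule.span_le.2 ?_) fun w hw => ?_
    · rintro _ ⟨k, rfl⟩
      exact (b k).2
    · obtain ⟨d, hd, x, hx, hxw⟩ := exists_integral_multiple hw
      have hd' : (d : ℚ) ≠ 0 := Int.cast_ne_zero.2 hd
      rw [← Submodule.smul_mem_iff _ hd']
      have : (d : ℚ) • w = f x := by
        ext i
        exact (hxw i).symm
      rw [this]
      have hs := b.sum_repr ⟨x, hx⟩
      have hs' := congrArg (f ∘ₗ (integralPoints W).subtype) hs
      rw [map_sum] at hs'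
      change _ = f x at hs'
      rw [← hs']
      refine Submodule.sum_mem _ fun k _ => ?_
      rw [map_smul, ← Int.cast_smul_eq_zsmul ℚ]
      exact Submodule.smul_mem _ _ (Submodule.subset_span ⟨k, rfl⟩)
  rw [← hspan, finrank_span_eq_card hli]

/-- A Lagrangian lattice that contains the integral points of an isotropic subspace `W` has a basis
whose last `dim W` vectors are a basis of these. -/
theorem exists_adapted_basis {q : ℕ} {W : Submodule ℚ (Vec n ℚ)}
    (hdim : Module.finrank ℚ W + q = n) {Λ : Submodule ℤ (Vec n ℤ)} (hΛ : IsLagrangianLattice Λ)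
    (hW : integralPoints W ≤ Λ) :
    ∃ b : Module.Basis (Fin n) ℤ Λ,
      (∀ i : Fin n, q ≤ (i : ℕ) → (b i : Vec n ℤ) ∈ integralPoints W) ∧
      integralPoints W ≤
        Submodule.span ℤ ((fun i => (b i : Vec n ℤ)) '' {i : Fin n | q ≤ (i : ℕ)}) := by
  let N := (integralPoints W).submoduleOf Λ
  have hfree : Module.Free ℤ (Λ ⧸ N) := free_quotient_of_saturated N fun c hc x hx =>
    integralPoints_saturated W c hc x hx
  let bW := Module.Free.chooseBasis ℤ (integralPoints W)
  let bN := bW.map (Submodule.submoduleOfEquivOfLe hW).symm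
  have hbN : ∀ k, ((bN k : Λ) : Vec n ℤ) = bW k := fun k => by
    simp [bN, Submodule.submoduleOfEquivOfLe]
  let bQ := Module.Free.chooseBasis ℤ (Λ ⧸ N)
  let B := bN.sumQuot bQ
  have hB : ∀ k, (B (Sum.inl k) : Vec n ℤ) = bW k := fun k => by
    rw [← hbN]
    exact congrArg Subtype.val (bN.sumQuot_inl bQ k)
  have h1 := card_basis_integralPoints bW
  have h2 := hΛ.card_basis B
  rw [Fintype.card_sum] at h2
  let e1 := Fintype.equivFinOfCardEq h1
  let e2 := Fintype.equivFinOfCardEq (show Fintype.card _ = q by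
    exact (by omega : Fintype.card (Module.Free.ChooseBasisIndex ℤ (Λ ⧸ N)) = q))
  -- The order is reversed so that the basis of the integral points of `W` occupies the indices from
  -- `q` on, as in `stdRadical`.
  let e := ((Equiv.sumCongr e1 e2).trans (Equiv.sumComm _ _)).trans
    (finSumFinEquiv.trans (finCongr (show q + Module.finrank ℚ W = n by omega)))
  have he : ∀ k, ((e (Sum.inl k) : Fin n) : ℕ) = q + e1 k := fun k => rfl
  have he2 : ∀ k, ((e (Sum.inr k) : Fin n) : ℕ) = e2 k := fun k => rfl
  refine ⟨B.reindex e, fun i hi => ?_, fun x hx => ?_⟩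
  · rw [Module.Basis.reindex_apply]
    obtain ⟨k | k, rfl⟩ := e.surjective i
    · rw [Equiv.symm_apply_apply, hB]
      exact (bW k).2
    · rw [he2] at hi
      have := (e2 k).2
      omega
  · have hs : _ = x := congrArg Subtype.val (bW.sum_repr ⟨x, hx⟩)
    rw [← hs, Submodule.coe_sum]
    refine Submodule.sum_mem _ fun k _ => Submodule.smul_mem _ _ (Submodule.subset_span
      ⟨e (Sum.inl k), ?_, ?_⟩)
    · change q ≤ _
      rw [he]
      omega
    · change ((B.reindex e (e (Sum.inl k)) : Λ) : Vec n ℤ) = _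
      rw [Module.Basis.reindex_apply, Equiv.symm_apply_apply, hB]

/-- The basis of a Lagrangian lattice adapted to `W` and its isotropic dual vectors are the columns
of `g`. The last `n - q` columns of its left half span `W`. -/
theorem exists_act_stdRadical_eq {q : ℕ} {W : Submodule ℚ (Vec n ℚ)}
    (hiso : ∀ x ∈ W, ∀ y ∈ W, sympForm x y = 0) (hdim : Module.finrank ℚ W + q = n) :
    ∃ g : Sp n ℤ, act g (stdRadical n q) = complexify W := by
  obtain ⟨Λ, hWΛ, hΛ⟩ := exists_isLagrangianLattice_ge (integralPoints W) fun x hx y hy => by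
    have := hiso _ hx _ hy
    exact_mod_cast (sympForm_intCast (R := ℚ) x y).symm.trans this
  obtain ⟨b, hbW, hWb⟩ := exists_adapted_basis hdim hΛ hWΛ
  obtain ⟨y, hby, hy⟩ := hΛ.exists_isotropic_dual b
  obtain ⟨g, hg⟩ := exists_symplectic_of_columns
    (fun i j => (hΛ _).1 (b j).2 _ (b i).2) hy hby
  have hcol : ∀ i, cmat g *ᵥ Pi.single (Sum.inl i) 1 = fun k => (((b i : Vec n ℤ) k : ℤ) : ℂ) := by
    intro i
    ext k
    rw [cmat_mulVec_single, ← (hg i).1]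
    rfl
  refine ⟨g, le_antisymm ?_ ?_⟩
  · rintro _ ⟨x, hx, rfl⟩
    have hxs : x = ∑ i, x (Sum.inl i) • Pi.single (Sum.inl i) (1 : ℂ) := by
      conv_lhs => rw [← Finset.univ_sum_single x, Fintype.sum_sum_type]
      simp only [hx.1, Pi.single_zero, Finset.sum_const_zero, add_zero, ← Pi.single_smul,
        smul_eq_mul, mul_one]
    change cmat g *ᵥ x ∈ _
    rw [hxs, mulVec_sum]
    refine Submodule.sum_mem _ fun i _ => ?_
    rw [mulVec_smul, hcol]
    rcases lt_or_ge (i : ℕ) q with hi | hi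
    · rw [hx.2 i hi, zero_smul]
      exact Submodule.zero_mem _
    · refine Submodule.smul_mem _ _ (Submodule.subset_span ⟨_, hbW i hi, ?_⟩)
      ext k
      simp
  · refine Submodule.span_le.2 ?_
    rintro _ ⟨w, hw, rfl⟩
    obtain ⟨d, hd, x, hx, hxw⟩ := exists_integral_multiple hw
    have hx' : (fun i => (x i : ℂ)) ∈ act g (stdRadical n q) := by
      have hle : Submodule.span ℤ ((fun i => (b i : Vec n ℤ)) '' {i : Fin n | q ≤ (i : ℕ)}) ≤
          ((act g (stdRadical n q)).restrictScalars ℤ).comap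
            ((Algebra.linearMap ℤ ℂ).compLeft (Fin n ⊕ Fin n)) := by
        refine Submodule.span_le.2 ?_
        rintro _ ⟨i, hi, rfl⟩
        change (fun k => (((b i : Vec n ℤ) k : ℤ) : ℂ)) ∈ act g (stdRadical n q)
        rw [← hcol, mulVec_mem_act]
        refine ⟨fun i => rfl, fun k hk => Pi.single_eq_of_ne (fun h => ?_) _⟩
        rw [Sum.inl_injective h] at hk
        exact absurd hk (not_lt.2 hi)
      exact hle (hWb hx)
    have hd' : (d : ℂ) ≠ 0 := Int.cast_ne_zero.2 hd
    refine (Submodule.smul_mem_iff _ hd').1 ?_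
    convert hx' using 1
    ext i
    have : ((x i : ℚ) : ℂ) = ((d * w i : ℚ) : ℂ) := by rw [hxw]
    simpa using this.symm

end Lattice

/-! ### Congruence subgroups -/

section Congruence

variable {n : ℕ}

theorem mem_Gam_iff {N : ℕ} {γ : Sp n ℤ} : γ ∈ Gam n N ↔ ∃ X, γ.1 = 1 + (N : ℤ) • X := by
  have h : γ ∈ Gam n N ↔ ∀ i j, (N : ℤ) ∣ (γ.1 - 1) i j := by
    have h1 : γ ∈ Gam n N ↔ γ.1.map (Int.castRingHom (ZMod N)) = 1 :=
      ⟨fun h => congrArg Subtype.val h, fun h => Subtype.ext h⟩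
    rw [h1, ← Matrix.ext_iff]
    refine forall₂_congr fun i j => ?_
    rw [Matrix.sub_apply, ← ZMod.intCast_eq_intCast_iff_dvd_sub, eq_comm]
    simp [Matrix.one_apply, apply_ite (Int.cast : ℤ → ZMod N)]
  rw [h]
  constructor
  · intro h
    choose X hX using h
    refine ⟨Matrix.of X, ?_⟩
    ext i j
    change γ.1 i j = (1 : Matrix _ _ ℤ) i j + (N : ℤ) * X i j
    rw [← hX, Matrix.sub_apply, add_sub_cancel]
  · rintro ⟨X, hX⟩ i j
    rw [hX, add_sub_cancel_left, Matrix.smul_apply, smul_eq_mul]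
    exact dvd_mul_right _ _

theorem Gam_le_of_dvd {M N : ℕ} (h : M ∣ N) : Gam n N ≤ Gam n M := by
  intro γ hγ
  obtain ⟨X, hX⟩ := mem_Gam_iff.1 hγ
  obtain ⟨c, rfl⟩ := h
  refine mem_Gam_iff.2 ⟨(c : ℤ) • X, ?_⟩
  rw [hX, smul_smul, Nat.cast_mul]

theorem tau_coe_apply (g : Sp n ℤ) : (tau g).1 = Iminus n ℤ * g.1 * Iminus n ℤ := rfl

/-- Conjugation by `I₋` changes the sign of the off-diagonal blocks and fixes the diagonal ones.
This supplies the extra factor 2 that raises the level of `γ̃γ` from `4m` to `8m`. -/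
theorem exists_add_Iminus_conj (X : Matrix (Fin n ⊕ Fin n) (Fin n ⊕ Fin n) ℤ) :
    ∃ Y, X + Iminus n ℤ * X * Iminus n ℤ = (2 : ℤ) • Y := by
  refine ⟨fromBlocks X.toBlocks₁₁ 0 0 X.toBlocks₂₂, ?_⟩
  conv_lhs => rw [← fromBlocks_toBlocks X]
  rw [fromBlocks_smul]
  simp [Iminus, fromBlocks_multiply, fromBlocks_add, two_mul]

theorem tau_mul_self_mem_Gam {m : ℕ} {γ : Sp n ℤ} (hγ : γ ∈ Gam n (4 * m)) :
    tau γ * γ ∈ Gam n (8 * m) := by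
  obtain ⟨X, hX⟩ := mem_Gam_iff.1 hγ
  obtain ⟨Y, hY⟩ := exists_add_Iminus_conj X
  have ht : (tau γ).1 = 1 + ((4 * m : ℕ) : ℤ) • (Iminus n ℤ * X * Iminus n ℤ) := by
    rw [tau_coe_apply, hX, Matrix.mul_add, Matrix.add_mul, Matrix.mul_one, Iminus_mul_self,
      Matrix.mul_smul, Matrix.smul_mul]
  refine mem_Gam_iff.2 ⟨Y + (2 * m : ℤ) • (Iminus n ℤ * X * Iminus n ℤ * X), ?_⟩
  change (tau γ).1 * γ.1 = _
  rw [ht, hX]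
  set Z := Iminus n ℤ * X * Iminus n ℤ
  have : (1 + ((4 * m : ℕ) : ℤ) • Z) * (1 + ((4 * m : ℕ) : ℤ) • X) =
      1 + ((4 * m : ℕ) : ℤ) • (X + Z) + ((4 * m : ℕ) * (4 * m : ℕ) : ℤ) • (Z * X) := by
    simp only [Matrix.add_mul, Matrix.mul_add, Matrix.one_mul, Matrix.mul_one, Matrix.smul_mul,
      Matrix.mul_smul, smul_add, smul_smul]
    abel
  rw [this, hY]
  push_cast
  module

theorem tau_inv_mul_mem_Gam_two (a : Sp n ℤ) : (tau a)⁻¹ * a ∈ Gam n 2 := by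
  change Sp.map (Int.castRingHom (ZMod 2)) ((tau a)⁻¹ * a) = 1
  rw [map_mul, map_inv, inv_mul_eq_one]
  refine Subtype.ext ?_
  change (tau a).1.map (Int.castRingHom (ZMod 2)) = a.1.map (Int.castRingHom (ZMod 2))
  have h : (Iminus n ℤ).map (Int.castRingHom (ZMod 2)) = 1 := by
    rw [Iminus, fromBlocks_map, ← fromBlocks_one, Matrix.map_zero _ (map_zero _),
      Matrix.map_one _ (map_zero _) (map_one _)]
    congr 1
    ext i j
    simp only [map_apply, Matrix.neg_apply, Matrix.one_apply]
    split_ifs <;> rfl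
  rw [tau_coe_apply, Matrix.map_mul, Matrix.map_mul, h, Matrix.one_mul, Matrix.mul_one]

instance Gam_normal (N : ℕ) : (Gam n N).Normal := by
  unfold Gam
  infer_instance

/-- Twisted and ordinary conjugation differ by the factor `ã⁻¹a`, which is trivial modulo 2 because
`I₋` is. -/
theorem twisted_conj_mem_Gam_two {γ : Sp n ℤ} (hγ : γ ∈ Gam n 2) (a : Sp n ℤ) :
    (tau a)⁻¹ * γ * a ∈ Gam n 2 := by
  have : (tau a)⁻¹ * γ * a = (tau a)⁻¹ * a * (a⁻¹ * γ * a) := by group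
  rw [this]
  refine mul_mem (tau_inv_mul_mem_Gam_two a) ?_
  simpa using (Gam_normal 2).conj_mem γ hγ a⁻¹

theorem tau_mul_twisted_conj_mem_Gam {N : ℕ} {γ : Sp n ℤ} (hγ : tau γ * γ ∈ Gam n N)
    (a : Sp n ℤ) : tau ((tau a)⁻¹ * γ * a) * ((tau a)⁻¹ * γ * a) ∈ Gam n N := by
  have : tau ((tau a)⁻¹ * γ * a) * ((tau a)⁻¹ * γ * a) = a⁻¹ * (tau γ * γ) * a := by
    rw [map_mul, map_mul, map_inv, tau_tau]
    group
  rw [this]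
  simpa using (Gam_normal N).conj_mem _ hγ a⁻¹

theorem nu_mem_Gam {q N : ℕ} (hq : q ≤ n) {g : Sp n ℤ} (hg : g ∈ parabolic n q ℤ)
    (h : g ∈ Gam n N) : nu hq ℤ ⟨g, hg⟩ ∈ Gam q N := by
  obtain ⟨X, hX⟩ := mem_Gam_iff.1 h
  refine mem_Gam_iff.2 ⟨X.submatrix (hermIdx hq) (hermIdx hq), ?_⟩
  change g.1.submatrix _ _ = _
  rw [hX, submatrix_add, ← submatrix_one _ (hermIdx_injective hq)]
  rfl

end Congruence

/-! ### Real structures on `ℤ^{2q}` congruent to the standard one modulo 2 -/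

section Involution

variable {q : ℕ}

theorem sympForm_Iminus (x y : Vec q ℤ) :
    sympForm (Iminus q ℤ *ᵥ x) (Iminus q ℤ *ᵥ y) = -sympForm x y := by
  simp only [sympForm, Iminus, fromBlocks_mulVec, neg_mulVec, one_mulVec, zero_mulVec,
    Sum.elim_inl, Sum.elim_inr, ← Finset.sum_neg_distrib]
  refine Finset.sum_congr rfl fun i _ => ?_
  simp
  ring

/-- The integral involution `S = I₋γ` reverses the sign of the symplectic form, so both its
eigenlattices are isotropic. As `S ≡ 1` modulo 2, the projections `(1 ± S)/2` are integral and the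
eigenlattices span `ℤ^{2q}`. In a symplectic basis adapted to them `S` becomes `I₋`. -/
theorem exists_tau_eq_mul {γ : Sp q ℤ} (hγ : γ ∈ Gam q 2) (hinv : tau γ * γ = 1) :
    ∃ b : Sp q ℤ, γ * b = tau b := by
  set S : Matrix (Fin q ⊕ Fin q) (Fin q ⊕ Fin q) ℤ := Iminus q ℤ * γ.1 with hS
  have hSS : ∀ x, S *ᵥ (S *ᵥ x) = x := fun x => by
    have h1 : (tau γ).1 * γ.1 = 1 := congrArg Subtype.val hinv
    have : S * S = 1 := by
      rw [← h1, tau_coe_apply, hS]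
      simp only [Matrix.mul_assoc]
    rw [mulVec_mulVec, this, one_mulVec]
  have hform : ∀ x y, sympForm (S *ᵥ x) (S *ᵥ y) = -sympForm x y := fun x y => by
    rw [hS, ← mulVec_mulVec, ← mulVec_mulVec, sympForm_Iminus, sympForm_mulVec γ.2]
  have hhalf : ∀ x, ∃ p, x + S *ᵥ x = (2 : ℤ) • p := by
    obtain ⟨X, hX⟩ := mem_Gam_iff.1 hγ
    have h1 : (1 + S : Matrix (Fin q ⊕ Fin q) (Fin q ⊕ Fin q) ℤ) =
        (2 : ℤ) • (fromBlocks 0 0 0 1 + Iminus q ℤ * X) := by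
      rw [hS, hX, Matrix.mul_add, Matrix.mul_one, ← add_assoc, smul_add, Matrix.mul_smul]
      congr 1
      rw [Iminus, ← fromBlocks_one, fromBlocks_add, fromBlocks_smul]
      simp [two_smul, ← two_mul]
    intro x
    refine ⟨(fromBlocks 0 0 0 1 + Iminus q ℤ * X) *ᵥ x, ?_⟩
    rw [← smul_mulVec, ← h1, add_mulVec, one_mulVec]
  have hinj : ∀ x y : Vec q ℤ, (2 : ℤ) • x = (2 : ℤ) • y → x = y := fun x y h =>
    smul_right_injective _ two_ne_zero h
  have hsplit : ∀ x, ∃ p, S *ᵥ p = p ∧ S *ᵥ (x - p) = -(x - p) := by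
    intro x
    obtain ⟨p, hp⟩ := hhalf x
    have h1 : S *ᵥ p = p := by
      refine hinj _ _ ?_
      rw [← mulVec_smul, ← hp, mulVec_add, hSS, add_comm]
    refine ⟨p, h1, ?_⟩
    rw [mulVec_sub, h1, eq_sub_of_add_eq' hp]
    module
  let Λ : Submodule ℤ (Vec q ℤ) := (S.mulVecLin + LinearMap.id).ker
  have hmem : ∀ x, x ∈ Λ ↔ S *ᵥ x = -x := fun x => by
    rw [LinearMap.mem_ker, ← add_eq_zero_iff_eq_neg]
    rfl
  have hself : ∀ s : ℤ, s = -s → s = 0 := fun s h => by omega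
  have hminus : ∀ x ∈ Λ, ∀ y ∈ Λ, sympForm x y = 0 := fun x hx y hy => by
    have h := hform x y
    rw [(hmem x).1 hx, (hmem y).1 hy] at h
    refine hself _ (Eq.trans ?_ h)
    rw [← sympBilin_apply (-x)]
    simp only [map_neg, LinearMap.neg_apply, neg_neg, sympBilin_apply]
  have hplus : ∀ x y : Vec q ℤ, S *ᵥ x = x → S *ᵥ y = y → sympForm x y = 0 := fun x y hx hy => by
    have h := hform x y
    rw [hx, hy] at h
    exact hself _ h
  have hΛ : IsLagrangianLattice Λ := by
    refine fun x => ⟨fun hx y hy => hminus y hy x hx, fun h => ?_⟩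
    obtain ⟨p, hp, hp'⟩ := hsplit x
    -- The fixed part `p` of `x` is orthogonal to `Λ`, as `x` and `x - p` are, and to all fixed
    -- vectors, hence to everything.
    have hp0 : p = 0 := by
      refine eq_zero_of_sympForm fun z => ?_
      obtain ⟨w, hw, hw'⟩ := hsplit z
      have h1 : sympForm (z - w) p = 0 := by
        have := h _ ((hmem _).2 hw')
        rw [← sub_add_cancel x p, sympForm_add_right, hminus _ ((hmem _).2 hw') _ ((hmem _).2 hp'),
          zero_add] at this
        exact this
      rw [← sub_add_cancel z w, sympForm_add_left, h1, hplus w p hw hp, add_zero]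
    rw [hp0, sub_zero] at hp'
    exact (hmem x).2 hp'
  let b₀ := Module.Free.chooseBasis ℤ Λ
  let b := b₀.reindex (Fintype.equivFinOfCardEq (hΛ.card_basis b₀))
  obtain ⟨y, hy⟩ := hΛ.exists_dual b
  choose p hp hp' using fun j => hsplit (y j)
  obtain ⟨g, hg⟩ := exists_symplectic_of_columns (b := fun i => (b i : Vec q ℤ)) (y := p)
    (fun i j => hminus _ (b i).2 _ (b j).2) (fun i j => hplus _ _ (hp i) (hp j)) (fun i j => by
      rw [← hy, ← sub_add_cancel (y j) (p j), sympForm_add_right,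
        hminus _ (b i).2 _ ((hmem _).2 (hp' j)), zero_add])
  -- The left columns of `g` lie in the `-1`-eigenlattice, the right ones in the fixed lattice.
  have hSg : S * g.1 = g.1 * Iminus q ℤ := by
    refine Matrix.ext_of_mulVec_single fun i => ?_
    rw [← mulVec_mulVec _ S g.1, ← mulVec_mulVec _ g.1 (Iminus q ℤ), mulVec_single_one g.1]
    rcases i with i | i
    · have : Iminus q ℤ *ᵥ Pi.single (Sum.inl i) 1 = -Pi.single (Sum.inl i) 1 := by
        ext (j | j) <;> simp [Iminus, fromBlocks_apply₁₁, Matrix.one_apply, Pi.single_apply]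
      rw [this, mulVec_neg, mulVec_single_one, (hg i).1]
      exact (hmem _).1 (b i).2
    · have : Iminus q ℤ *ᵥ Pi.single (Sum.inr i) 1 = Pi.single (Sum.inr i) 1 := by
        ext (j | j) <;> simp [Iminus, Matrix.one_apply, Pi.single_apply]
      rw [this, mulVec_single_one, (hg i).2]
      exact hp i
  refine ⟨g, Subtype.ext ?_⟩
  change γ.1 * g.1 = (tau g).1
  rw [tau_coe_apply, Matrix.mul_assoc, ← hSg, hS, ← Matrix.mul_assoc, ← Matrix.mul_assoc,
    Iminus_mul_self, Matrix.one_mul]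

end Involution

/-! ### Real boundary pairs -/

section RealBoundaryPair

variable {n q : ℕ}

theorem tauPt_stdRadical (hq : q ≤ n) : tauPt (stdRadical n q) = stdRadical n q := by
  rw [stdRadical_eq_lift hq, tauPt_lift]
  congr 1
  ext x
  rw [mem_tauPt, Submodule.mem_bot, Submodule.mem_bot]
  constructor
  · intro h
    rw [← star_star x, ← Iminus_mulVec_self (star x), h]
    simp
  · rintro rfl
    simp

/-- `γ` carries the radical of `L` to that of `τ(L)`, and `τ` preserves the standard radical. -/
theorem mem_parabolic_of_tauPt_eq (hq : q ≤ n) {γ : Sp n ℤ} {L : Submodule ℂ (Vec n ℂ)}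
    (hL : L ∈ component (stdRadical n q)) (hγ : tauPt L = act γ L) : γ ∈ parabolic n q ℤ := by
  refine mem_parabolic_of_act_stdRadical ?_
  conv_lhs => rw [← hL.2.2]
  rw [act_inf, ← conj_act, ← hγ, tauPt_inf_conj, hL.2.2, tauPt_stdRadical hq]

theorem tauPt_act_of_tauPt_eq {γ : Sp n ℤ} {L : Submodule ℂ (Vec n ℂ)} (h : tauPt L = act γ L)
    (a : Sp n ℤ) : tauPt (act a⁻¹ L) = act ((tau a)⁻¹ * γ * a) (act a⁻¹ L) := by
  rw [tauPt_act, h, act_mul, act_act_inv, act_mul, map_inv]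

/-- A real structure that is trivial modulo 4 on a point of the standard component is conjugate by
an element of the Hermitian factor to one in `ker ν`. -/
theorem exists_embed_mem_kerNu (hq : q ≤ n) {γ : Sp n ℤ} (h2 : γ ∈ Gam n 2)
    (h4 : tau γ * γ ∈ Gam n 4) {L : Submodule ℂ (Vec n ℂ)}
    (hL : L ∈ component (stdRadical n q)) (hγ : tauPt L = act γ L) :
    ∃ b : Sp q ℤ, (tau (embed hq b))⁻¹ * γ * embed hq b ∈ kerNu hq ℤ := by
  have hpar := mem_parabolic_of_tauPt_eq hq hL hγ
  have htpar := tau_mem_parabolic hpar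
  rw [← lift_image hq] at hL
  obtain ⟨L', hL', rfl⟩ := hL
  rw [tauPt_lift, act_lift hq hpar] at hγ
  have hfix := lift_injective hq hγ
  set γh := nu hq ℤ ⟨γ, hpar⟩ with hγh
  have hmul : tau γh * γh = nu hq ℤ ⟨tau γ * γ, mul_mem htpar hpar⟩ := by
    rw [hγh, ← nu_tau, ← map_mul]
    rfl
  have hone : tau γh * γh = 1 := by
    have hmem : tau γh * γh ∈ Gam q 4 := by
      rw [hmul]
      exact nu_mem_Gam hq _ h4
    obtain ⟨X, hX⟩ := mem_Gam_iff.1 hmem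
    refine eq_one_of_act_eq hX hL' ?_
    -- From `τ(L') = γh L'` it follows that `γ̃h γh L' = τ(τ(L')) = L'`.
    rw [act_mul, ← hfix, ← tauPt_act, ← hfix, tauPt_tauPt]
  obtain ⟨b, hb⟩ := exists_tau_eq_mul (nu_mem_Gam hq hpar h2) hone
  refine ⟨b, mem_kerNu_iff_nu.2 ?_⟩
  have hbp := embed_mem_parabolic hq b
  have htbp := tau_mem_parabolic hbp
  refine ⟨mul_mem (mul_mem (inv_mem htbp) hpar) hbp, ?_⟩
  have : nu hq ℤ ⟨(tau (embed hq b))⁻¹ * γ * embed hq b,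
      mul_mem (mul_mem (inv_mem htbp) hpar) hbp⟩ =
      (nu hq ℤ ⟨tau (embed hq b), htbp⟩)⁻¹ * nu hq ℤ ⟨γ, hpar⟩ * nu hq ℤ ⟨embed hq b, hbp⟩ := by
    rw [nu_inv hq htbp (inv_mem htbp), ← map_mul, ← map_mul]
    rfl
  rw [this, nu_tau hq hbp, nu_embed, mul_assoc, hb, inv_mul_cancel]

/-- The elements of `ker ν` are block upper triangular. -/
theorem exists_fromBlocks_of_mem_kerNu {hq : q ≤ n} {g : Sp n ℤ} (hg : g ∈ kerNu hq ℤ) :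
    ∃ (A : GL (Fin n) ℤ) (B : Matrix (Fin n) (Fin n) ℤ),
      g.1 = fromBlocks A.1 B 0 ((A⁻¹ : GL (Fin n) ℤ) : Matrix (Fin n) (Fin n) ℤ).transpose := by
  obtain ⟨⟨h1, h2, h3, h4⟩, h⟩ := mem_kerNu.1 hg
  have hC : g.1.toBlocks₂₁ = 0 := by
    ext i j
    change g.1 (Sum.inr i) (Sum.inl j) = 0
    by_cases hi : q ≤ (i : ℕ)
    · exact h3 i j hi
    by_cases hj : q ≤ (j : ℕ)
    · exact h2 i j hj
    exact congrFun (congrFun h (Sum.inr ⟨i, not_le.1 hi⟩)) (Sum.inl ⟨j, not_le.1 hj⟩)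
  have hinv := congrArg Subtype.val (mul_inv_cancel g)
  change g.1 * (g⁻¹).1 = 1 at hinv
  rw [coe_inv_eq, hC, ← fromBlocks_toBlocks g.1, hC] at hinv
  simp only [toBlocks_fromBlocks₁₁, toBlocks_fromBlocks₁₂, toBlocks_fromBlocks₂₂,
    fromBlocks_multiply, ← fromBlocks_one, fromBlocks_inj] at hinv
  have hAD : g.1.toBlocks₁₁ * g.1.toBlocks₂₂ᵀ = 1 := by simpa using hinv.1
  refine ⟨⟨g.1.toBlocks₁₁, g.1.toBlocks₂₂ᵀ, hAD, mul_eq_one_comm.1 hAD⟩, g.1.toBlocks₁₂, ?_⟩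
  conv_lhs => rw [← fromBlocks_toBlocks g.1, hC]
  rfl

theorem tau_mem_kerNu {hq : q ≤ n} {g : Sp n ℤ} (hg : g ∈ kerNu hq ℤ) : tau g ∈ kerNu hq ℤ := by
  obtain ⟨hp, h⟩ := mem_kerNu_iff_nu.1 hg
  exact mem_kerNu_iff_nu.2 ⟨tau_mem_parabolic hp, by rw [nu_tau hq hp, h, map_one]⟩

/-- The translation `Z ↦ Z + T`. -/
def translation (T : Matrix (Fin n) (Fin n) ℤ) (hT : Tᵀ = T) : Sp n ℤ :=
  ⟨fromBlocks 1 T 0 1, by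
    rw [SymplecticGroup.mem_iff]
    simp [J, fromBlocks_multiply, fromBlocks_transpose, hT]⟩

/-- `τ` turns translation by `T` into translation by `-T`. Twisted conjugation by a translation thus
multiplies by the same translation on both sides. -/
theorem tau_inv_translation {T : Matrix (Fin n) (Fin n) ℤ} (hT : Tᵀ = T) :
    (tau (translation T hT))⁻¹ = translation T hT := by
  rw [inv_eq_iff_mul_eq_one]
  refine Subtype.ext ?_
  change (tau (translation T hT)).1 * fromBlocks 1 T 0 1 = 1
  rw [tau_coe_fromBlocks rfl, fromBlocks_multiply, ← fromBlocks_one]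
  simp

theorem translation_mem_kerNu (hq : q ≤ n) {T : Matrix (Fin n) (Fin n) ℤ} (hT : Tᵀ = T)
    (h0 : ∀ i j : Fin n, (i : ℕ) < q → (j : ℕ) < q → T i j = 0) :
    translation T hT ∈ kerNu hq ℤ := by
  obtain ⟨h1, h2, h3, h4⟩ := isParabolicShape_one (n := n) (R := ℤ) q
  refine mem_kerNu.2 ⟨⟨fun i j hi hj => ?_, fun i j hj => rfl, fun i j hi => rfl,
    fun i j hi hj => ?_⟩, ?_⟩
  · exact Matrix.one_apply_ne fun h => by subst h; omega
  · exact Matrix.one_apply_ne fun h => by subst h; omega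
  · rw [← submatrix_one _ (hermIdx_injective hq)]
    ext (i | i) (j | j)
    · simp [translation, hermIdx, Matrix.one_apply]
    · exact h0 _ _ i.2 j.2
    · rfl
    · simp [translation, hermIdx, Matrix.one_apply]

theorem translation_mem_Gam {N : ℕ} {T T' : Matrix (Fin n) (Fin n) ℤ} (hT : Tᵀ = T)
    (h : T = (N : ℤ) • T') : translation T hT ∈ Gam n N := by
  refine mem_Gam_iff.2 ⟨fromBlocks 0 T' 0 0, ?_⟩
  change fromBlocks 1 T 0 1 = _
  rw [← fromBlocks_one, fromBlocks_smul, fromBlocks_add, ← h]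
  simp

theorem smul_left_cancel_matrix {N : ℤ} (hN : N ≠ 0) {X Y : Matrix (Fin n) (Fin n) ℤ}
    (h : N • X = N • Y) : X = Y := by
  ext i j
  have := congrFun (congrFun h i) j
  exact mul_left_cancel₀ hN this

theorem toBlocks₁₂_one_add_smul (c : ℤ) (X : Matrix (Fin n ⊕ Fin n) (Fin n ⊕ Fin n) ℤ) :
    (1 + c • X).toBlocks₁₂ = c • X.toBlocks₁₂ := by
  ext i j
  change (1 : Matrix (Fin n ⊕ Fin n) (Fin n ⊕ Fin n) ℤ) (Sum.inl i) (Sum.inr j) + _ = _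
  rw [Matrix.one_apply_ne Sum.inl_ne_inr, zero_add]
  rfl

/-- An element of `ker ν` congruent to 1 modulo 2 and whose real norm is congruent to 1 modulo `8m`
becomes block diagonal after a translation of level `4m` and a change of coordinates. -/
theorem exists_translations {hq : q ≤ n} {m : ℕ} {δ : Sp n ℤ} (hδ : δ ∈ kerNu hq ℤ)
    (h2 : δ ∈ Gam n 2) (h8 : tau δ * δ ∈ Gam n (8 * m)) :
    ∃ u ∈ Gam n (4 * m), ∃ w : Sp n ℤ, u ∈ kerNu hq ℤ ∧ w ∈ kerNu hq ℤ ∧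
      ∃ A : GL (Fin n) ℤ, ((tau w)⁻¹ * δ * u * w).1 =
        fromBlocks A.1 0 0 ((A⁻¹ : GL (Fin n) ℤ) : Matrix (Fin n) (Fin n) ℤ).transpose := by
  obtain ⟨A, B, hAB⟩ := exists_fromBlocks_of_mem_kerNu hδ
  obtain ⟨⟨-, -, -, h4⟩, hone⟩ := mem_kerNu.1 hδ
  obtain ⟨D, hD⟩ : ∃ D, D = ((A⁻¹ : GL (Fin n) ℤ) : Matrix (Fin n) (Fin n) ℤ).transpose := ⟨_, rfl⟩
  rw [← hD] at hAB
  have hAD : A.1 * Dᵀ = 1 := by rw [hD, transpose_transpose]; exact A.mul_inv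
  have hDA : Dᵀ * A.1 = 1 := mul_eq_one_comm.1 hAD
  obtain ⟨X, hX⟩ := mem_Gam_iff.1 h2
  obtain ⟨E, hE⟩ := mem_Gam_iff.1 h8
  change (tau δ).1 * δ.1 = _ at hE
  rw [tau_coe_fromBlocks hAB, hAB, fromBlocks_multiply] at hE
  have hB : B = (2 : ℤ) • X.toBlocks₁₂ := by
    have := congrArg toBlocks₁₂ (hAB.symm.trans hX)
    rwa [toBlocks_fromBlocks₁₂, toBlocks₁₂_one_add_smul] at this
  set B₀ := X.toBlocks₁₂
  -- The upper right block of `δ̃δ` is `AB - BD = 2(AB₀ - B₀D)`; cancelling 2 from a congruence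
  -- modulo `8m` leaves one modulo `4m`.
  have hE' : A.1 * B₀ - B₀ * D = ((4 * m : ℕ) : ℤ) • E.toBlocks₁₂ := by
    apply smul_left_cancel_matrix two_ne_zero
    have h : A.1 * B + -B * D = ((8 * m : ℕ) : ℤ) • E.toBlocks₁₂ := by
      have := congrArg toBlocks₁₂ hE
      rwa [toBlocks_fromBlocks₁₂, toBlocks₁₂_one_add_smul] at this
    rw [hB, Matrix.mul_smul, Matrix.neg_mul, Matrix.smul_mul, ← sub_eq_add_neg, ← smul_sub] at h
    rw [h, smul_smul]
    push_cast
    ring_nf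
  have hsymm : Dᵀ * B = Bᵀ * D := by
    have h := SymplecticGroup.mem_iff'.1 δ.2
    rw [hAB] at h
    have h22 := congrArg toBlocks₂₂ h
    simp only [J, fromBlocks_transpose, fromBlocks_multiply, toBlocks_fromBlocks₂₂] at h22
    simp at h22
    rw [← sub_eq_zero, ← h22]
    abel
  have hS : (Dᵀ * B₀)ᵀ = Dᵀ * B₀ := by
    apply smul_left_cancel_matrix two_ne_zero
    rw [← transpose_smul, ← Matrix.mul_smul, ← hB, hsymm, transpose_mul, transpose_transpose,
      hsymm]
  set S := Dᵀ * B₀ with hSdef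
  have hT : (Dᵀ * S * D - S)ᵀ = Dᵀ * S * D - S := by
    rw [transpose_sub, transpose_mul, transpose_mul, transpose_transpose, hS,
      Matrix.mul_assoc Dᵀ S D]
  -- Multiplying by translations by `-S` on the left and by `T - S` on the right changes `B` to `B +
  -- A(T - S) - SD`. As `AS = B₀` and `B = 2B₀`, this vanishes exactly when `AT = SD - B₀`, that is,
  -- for this `T`.
  set T := Dᵀ * S * D - S with hTdef
  -- `T = ᵗD ᵗD (B₀D - AB₀)`, because `ᵗD A = 1`.
  have hT4 : T = ((4 * m : ℕ) : ℤ) • -(Dᵀ * Dᵀ * E.toBlocks₁₂) := by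
    rw [smul_neg, ← Matrix.mul_smul, ← hE', Matrix.mul_sub, neg_sub, hTdef, hSdef]
    congr 1
    · simp only [Matrix.mul_assoc]
    · calc Dᵀ * B₀ = Dᵀ * (Dᵀ * A.1) * B₀ := by rw [hDA, Matrix.mul_one]
        _ = _ := by simp only [Matrix.mul_assoc]
  -- The parabolic shape of `D` and the vanishing of the `q × q` block of `B₀`, due to `ν(δ) = 1`,
  -- pass to `S` and `T`; hence the translations lie in `ker ν`.
  have hD0 : ∀ i k : Fin n, (i : ℕ) < q → q ≤ (k : ℕ) → D k i = 0 := fun i k hi hk => by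
    have := h4 k i hk hi
    rwa [hAB] at this
  have hB0 : ∀ i j : Fin n, (i : ℕ) < q → (j : ℕ) < q → B₀ i j = 0 := fun i j hi hj => by
    have h := congrFun (congrFun hone (Sum.inl ⟨i, hi⟩)) (Sum.inr ⟨j, hj⟩)
    have h' : B i j = 0 := by
      rw [hAB] at h
      exact h
    rw [hB, Matrix.smul_apply, smul_eq_mul] at h'
    omega
  have hS0 : ∀ i j : Fin n, (i : ℕ) < q → (j : ℕ) < q → S i j = 0 := fun i j hi hj => by
    rw [hSdef, Matrix.mul_apply]
    refine Finset.sum_eq_zero fun k _ => ?_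
    rcases lt_or_ge (k : ℕ) q with hk | hk
    · rw [hB0 k j hk hj, mul_zero]
    · rw [transpose_apply, hD0 i k hi hk, zero_mul]
  have hDS0 : ∀ i j : Fin n, (i : ℕ) < q → (j : ℕ) < q → (Dᵀ * S) i j = 0 := fun i j hi hj => by
    rw [Matrix.mul_apply]
    refine Finset.sum_eq_zero fun k _ => ?_
    rcases lt_or_ge (k : ℕ) q with hk | hk
    · rw [hS0 k j hk hj, mul_zero]
    · rw [transpose_apply, hD0 i k hi hk, zero_mul]
  have hT0 : ∀ i j : Fin n, (i : ℕ) < q → (j : ℕ) < q → T i j = 0 := fun i j hi hj => by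
    rw [hTdef, Matrix.sub_apply, hS0 i j hi hj, sub_zero, Matrix.mul_apply]
    refine Finset.sum_eq_zero fun k _ => ?_
    rcases lt_or_ge (k : ℕ) q with hk | hk
    · rw [hDS0 i k hi hk, zero_mul]
    · rw [hD0 j k hj hk, mul_zero]
  have hnS : (-S)ᵀ = -S := by rw [transpose_neg, hS]
  refine ⟨translation T hT, translation_mem_Gam hT hT4, translation (-S) hnS,
    translation_mem_kerNu hq hT hT0, translation_mem_kerNu hq hnS fun i j hi hj => ?_, A, ?_⟩
  · rw [Matrix.neg_apply, hS0 i j hi hj, neg_zero]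
  · rw [tau_inv_translation, ← hD]
    change fromBlocks 1 (-S) 0 1 * δ.1 * fromBlocks 1 T 0 1 * fromBlocks 1 (-S) 0 1 = _
    have hAS : A.1 * S = B₀ := by rw [hSdef, ← Matrix.mul_assoc, hAD, Matrix.one_mul]
    have hAT : A.1 * T = S * D - B₀ := by
      rw [hTdef, Matrix.mul_sub, hAS, Matrix.mul_assoc, ← Matrix.mul_assoc, hAD, Matrix.one_mul]
    have hB2 : B = B₀ + B₀ := by rw [hB, two_smul]
    rw [hAB, fromBlocks_multiply, fromBlocks_multiply, fromBlocks_multiply]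
    congr 1
    · simp
    · simp [hAT, hAS, hB2]
      abel
    · simp
    · simp

end RealBoundaryPair

end SatakeSiegel

end

/-! ### Normalization of a real boundary pair -/

theorem mainTheorem11 (n q m : ℕ) (hq : q ≤ n) (hm : 1 ≤ m)
    (F : Set (Submodule ℂ (SatakeSiegel.Vec n ℂ))) (γ : SatakeSiegel.Sp n ℤ)
    (hF : SatakeSiegel.IsRealBoundaryPair m q F γ) :
    (∃ a : SatakeSiegel.Sp n ℤ,
      SatakeSiegel.act a '' SatakeSiegel.stdComponent n hq = F ∧
      (∃ (A : GL (Fin n) ℤ) (B : Matrix (Fin n) (Fin n) ℤ),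
        (((SatakeSiegel.tau a)⁻¹ * γ * a : SatakeSiegel.Sp n ℤ) :
          Matrix (Fin n ⊕ Fin n) (Fin n ⊕ Fin n) ℤ) =
          Matrix.fromBlocks (A : Matrix (Fin n) (Fin n) ℤ) B 0
            ((A⁻¹ : GL (Fin n) ℤ) : Matrix (Fin n) (Fin n) ℤ).transpose) ∧
      (SatakeSiegel.tau a)⁻¹ * γ * a ∈ SatakeSiegel.kerNu hq ℤ) ∧
    (∃ γ' ∈ SatakeSiegel.Gam n (4 * m), ∃ g : SatakeSiegel.Sp n ℤ,
      SatakeSiegel.realPoints F γ' = SatakeSiegel.realPoints F γ ∧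
      SatakeSiegel.act g '' SatakeSiegel.stdComponent n hq = F ∧
      (∃ A : GL (Fin n) ℤ,
        (((SatakeSiegel.tau g)⁻¹ * γ' * g : SatakeSiegel.Sp n ℤ) :
          Matrix (Fin n ⊕ Fin n) (Fin n ⊕ Fin n) ℤ) =
          Matrix.fromBlocks (A : Matrix (Fin n) (Fin n) ℤ) 0 0
            ((A⁻¹ : GL (Fin n) ℤ) : Matrix (Fin n) (Fin n) ℤ).transpose) ∧
      (SatakeSiegel.tau g)⁻¹ * γ' * g ∈ SatakeSiegel.kerNu hq ℤ) := by
  open SatakeSiegel in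
  obtain ⟨⟨W, hiso, hdim, rfl⟩, hγ, x, hx, hxγ⟩ := hF
  obtain ⟨a₀, ha₀⟩ := exists_act_stdRadical_eq hiso hdim
  have h8 := tau_mul_self_mem_Gam hγ
  have h2 : γ ∈ Gam n 2 := Gam_le_of_dvd ⟨2 * m, by ring⟩ hγ
  have hL : act a₀⁻¹ x ∈ component (stdRadical n q) := by
    rw [boundaryComponent_eq, ← ha₀] at hx
    simpa only [act_inv_act] using act_mem_component hx a₀⁻¹
  -- Level 4 of the norm suffices for the rigidity on the Hermitian factor; the full level `8m` is
  -- needed only for the translations.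
  obtain ⟨b, hb⟩ := exists_embed_mem_kerNu hq (twisted_conj_mem_Gam_two h2 a₀)
    (tau_mul_twisted_conj_mem_Gam (Gam_le_of_dvd ⟨2 * m, by ring⟩ h8) a₀) hL
    (tauPt_act_of_tauPt_eq hxγ a₀)
  obtain ⟨a, ha⟩ : ∃ a, a = a₀ * embed hq b := ⟨_, rfl⟩
  have hδ : (tau a)⁻¹ * γ * a ∈ kerNu hq ℤ := by
    have : (tau a)⁻¹ * γ * a =
        (tau (embed hq b))⁻¹ * ((tau a₀)⁻¹ * γ * a₀) * embed hq b := by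
      rw [ha, map_mul]
      group
    rwa [this]
  have haF : act a '' stdComponent n hq = boundaryComponent W := by
    rw [stdComponent_eq, act_image_component, ha, act_mul,
      act_stdRadical hq (embed_mem_parabolic hq b), ha₀, boundaryComponent_eq]
  refine ⟨⟨a, haF, exists_fromBlocks_of_mem_kerNu hδ, hδ⟩, ?_⟩
  obtain ⟨u, hu, w, huk, hwk, A, hA⟩ := exists_translations hδ (twisted_conj_mem_Gam_two h2 a)
    (tau_mul_twisted_conj_mem_Gam h8 a)
  have hconj : (tau (a * w))⁻¹ * (γ * (a * u * a⁻¹)) * (a * w) =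
      (tau w)⁻¹ * ((tau a)⁻¹ * γ * a) * u * w := by
    rw [map_mul]
    group
  -- The correction `a u a⁻¹` lies in `Γ(4m)` by normality and fixes `F` pointwise, since `u ∈ ker
  -- ν` fixes `F_q` pointwise; so `γ` and the corrected element have the same real points.
  refine ⟨γ * (a * u * a⁻¹), mul_mem hγ ((Gam_normal _).conj_mem u hu a), a * w, ?_, ?_,
    ⟨A, by rw [hconj, hA]⟩, ?_⟩
  · ext L
    refine and_congr_right fun hLF => ?_
    obtain ⟨L, hL, rfl⟩ := haF ▸ hLF
    rw [act_mul γ, act_mul, act_mul, act_inv_act, act_of_mem_kerNu hq huk hL]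
  · rw [← haF]
    refine Set.image_congr fun L hL => ?_
    rw [act_mul, act_of_mem_kerNu hq hwk hL]
  · rw [hconj]
    exact mul_mem (mul_mem (mul_mem (inv_mem (tau_mem_kerNu hwk)) hδ) huk) hwk
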